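/- Let $q$ be a formal variable; all parameters are integers, and $a_n\sim b_n$ means $a_n=(1+o(1))\,b_n$ as $n\to\infty$ with the parameters fixed. (1) For all integers $m>1$ and $h\ge 1$, the coefficients $a_n$ of $$\prod_{k=1}^{\infty}\left(\frac{1-q^{mk}}{1-q^k}\right)^h=\sum_{n\ge 0}a_nq^n$$ satisfy $$a_n\sim\frac{h^{1/4}(m-1)^{1/4}\exp\left(\pi\sqrt{\frac{2h(m-1)n}{3m}}\right)}{2^{5/4}\,3^{1/4}\,m^{\frac14+\frac h2}\,n^{3/4}}.$$ (2) For every integer $m\ge 0$, the coefficients $a_n$ of $$\prod_{k=1}^{\infty}\frac{1-q^{(2m+1)k}}{1-q^{2k}}=\sum_{n\ge 0}a_nq^n$$ satisfy $$a_n\sim(-1)^n\frac{(4m+1)^{1/4}}{2^{7/4}\,3^{1/4}\,(2m+1)^{3/4}\,n^{3/4}}\exp\left(\pi\sqrt{\frac{(4m+1)n}{6(2m+1)}}\right).$$ -/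

import Mathlib

open PowerSeries
open scoped PowerSeries.WithPiTopology

noncomputable section

/-- The quotient `(1 - q ^ a) / (1 - q ^ b)`, as a formal power series in `q`; it is used only
for `b ≥ 1`, where `1 - q ^ b` is invertible and the formal inverse is the true one. -/
def qRatio (a b : ℕ) : ℝ⟦X⟧ := (1 - X ^ a) * (1 - X ^ b)⁻¹

/-- `∏_{k ≥ 1} ((1 - q ^ (s k)) / (1 - q ^ (t k))) ^ h`, an infinite product of formal power series
(coefficientwise convergence). The index `k` runs over `ℕ` and stands for `k + 1`. -/
def qProduct (s t h : ℕ) : ℝ⟦X⟧ :=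
  ∏' k : ℕ, qRatio (s * (k + 1)) (t * (k + 1)) ^ h

theorem qRatio_mul {a b : ℕ} (hb : 1 ≤ b) : qRatio a b * (1 - X ^ b) = 1 - X ^ a := by
  have h : constantCoeff (1 - X ^ b : ℝ⟦X⟧) ≠ 0 := by
    have : b ≠ 0 := by omega
    simp [this]
  rw [qRatio, mul_assoc, PowerSeries.inv_mul_cancel _ h, mul_one]

/-- The infinite product really converges, so that `qProduct` is not a default value. -/
theorem qProduct_multipliable {s t : ℕ} (hs : 1 ≤ s) (ht : 1 ≤ t) (h : ℕ) :
    Multipliable fun k : ℕ => qRatio (s * (k + 1)) (t * (k + 1)) ^ h := by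
  have hd : ∀ k : ℕ, (X : ℝ⟦X⟧) ^ (k + 1) ∣
      qRatio (s * (k + 1)) (t * (k + 1)) ^ h - 1 := by
    intro k
    have hb : 1 ≤ t * (k + 1) := Nat.mul_pos ht (Nat.succ_pos k)
    have h0 : constantCoeff (1 - X ^ (t * (k + 1)) : ℝ⟦X⟧) ≠ 0 := by
      have : t * (k + 1) ≠ 0 := by omega
      rw [map_sub, map_pow, map_one, constantCoeff_X, zero_pow this]
      norm_num
    have h1 : qRatio (s * (k + 1)) (t * (k + 1)) - 1 =
        (X ^ (t * (k + 1)) - X ^ (s * (k + 1))) * (1 - X ^ (t * (k + 1)))⁻¹ := by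
      have := PowerSeries.mul_inv_cancel _ h0
      rw [qRatio]
      linear_combination this
    have h2 : (X : ℝ⟦X⟧) ^ (k + 1) ∣ qRatio (s * (k + 1)) (t * (k + 1)) - 1 := by
      rw [h1]
      exact Dvd.dvd.mul_right (dvd_sub (pow_dvd_pow _ (Nat.le_mul_of_pos_left _ ht))
        (pow_dvd_pow _ (Nat.le_mul_of_pos_left _ hs))) _
    have h3 := sub_dvd_pow_sub_pow (qRatio (s * (k + 1)) (t * (k + 1))) 1 h
    rw [one_pow] at h3
    exact h2.trans h3
  have hm : Multipliable fun k : ℕ =>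
      1 + (qRatio (s * (k + 1)) (t * (k + 1)) ^ h - 1) := by
    apply PowerSeries.WithPiTopology.multipliable_one_add_of_tendsto_order_atTop_nhds_top
    refine ENat.tendsto_nhds_top_iff_natCast_lt.mpr
      (fun n => Filter.eventually_atTop.mpr ⟨n, fun k hk => ?_⟩)
    refine lt_of_lt_of_le ?_ (nat_le_order _ (k + 1) (X_pow_dvd_iff.mp (hd k)))
    exact_mod_cast Nat.lt_succ_of_le hk
  simpa using hm

end

/-!
Both statements are instances of the circle method. Write `E(q) = ∏_{k ≥ 1} (1 - q ^ k)`
(`eulerProd`). The generating functions are `G(q) = (E(q ^ m) / E(q)) ^ h` and, after the change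
of sign `q ↦ -q` which produces the factor `(-1) ^ n`, `G(q) = E(-q ^ M) / E(q ^ 2)` with
`M = 2 m + 1`. In both cases `q = 1` is the dominant singularity on the unit circle.

*Near `q = 1`.* Since `E(-x) E(x) E(x ^ 4) = E(x ^ 2) ^ 3` (`eulerProd_neg_mul`), both functions
are quotients of values `E(q ^ d)` with total weight `0`. The transformation `τ ↦ -1 / τ` of the
Dedekind eta function evaluates them: if `q = e ^ (-z)` and `z → 0` in the wedge
`|Im z| ≤ Re z`, then `G(e ^ (-z)) e ^ (-A / z)` tends to a constant `l`, where `A > 0`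
(`tendsto_regular_wedge`, `tendsto_odd_wedge`).

*Away from `q = 1`.* Let `q = r u` with `r = e ^ (-t)` and `|u| = 1`. Comparing `|1 - q ^ k|`
with `1 - r ^ k` factor by factor bounds `|G(q)|` by `G(r)` times the exponential of a negative
multiple of `∑_{k ≡ 1 mod m} (r ^ k - Re q ^ k)` (`circleGap`). This sum is at least a constant
times `min (1, (|1 - u| / t) ^ 2) / t`: where `u ^ m` is not much closer to `1` than `u`, by
summing the geometric series in `q ^ m`; otherwise because `u ^ k` and `u ^ (2 k - 1)` cannot
both be close to `1` (`exists_circleGap_ge`). For the second family the products over `q ^ 2` and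
`q ^ M` are used together, since `u ^ 2` and `u ^ M` are both close to `1` only when `u` is.

*Conclusion.* Cauchy's formula on the circle of radius `e ^ (-√(A / n))`, which passes through
the saddle point of `e ^ (A / z + n z)`, becomes a Gaussian integral in the scale
`z = √(A / n) (1 - i v / (A n) ^ (1 / 4))`; the two estimates above give a dominating function,
so that dominated convergence applies (`isEquivalent_coeff_of_saddle`). Cauchy's formula itself
passes from the partial products to the infinite product by bounded convergence
(`two_pi_mul_coeff_qProduct`).
-/

/-! ### The saddle-point method on a circle -/

open Filter MeasureTheory Topology in
/-- `exp (-κ s)` decays faster than `(1 + s) ^ (-3)`. -/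
theorem exp_neg_mul_le_div_one_add_pow_three {κ : ℝ} (hκ : 0 < κ) :
    ∃ C : ℝ, 0 < C ∧ ∀ s : ℝ, 0 ≤ s → Real.exp (-(κ * s)) ≤ C / (1 + s) ^ 3 := by
  set d := min 1 (κ / 3) with hd
  have hd0 : 0 < d := lt_min one_pos (by positivity)
  refine ⟨(d ^ 3)⁻¹, by positivity, fun s hs => ?_⟩
  have h1 : d * (1 + s) ≤ Real.exp (κ * s / 3) := by
    have := Real.add_one_le_exp (κ * s / 3)
    have h2 : d ≤ 1 := min_le_left _ _
    have h3 : d * s ≤ κ / 3 * s := mul_le_mul_of_nonneg_right (min_le_right _ _) hs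
    linarith
  have h2 : (d * (1 + s)) ^ 3 ≤ Real.exp (κ * s) := by
    calc (d * (1 + s)) ^ 3 ≤ Real.exp (κ * s / 3) ^ 3 := pow_le_pow_left₀ (by positivity) h1 3
      _ = Real.exp (κ * s) := by rw [← Real.exp_nat_mul]; congr 1; push_cast; ring
  rw [Real.exp_neg, ← one_div, div_le_div_iff₀ (Real.exp_pos _) (by positivity), one_mul]
  calc (1 + s) ^ 3 = (d ^ 3)⁻¹ * (d * (1 + s)) ^ 3 := by field_simp
    _ ≤ _ := by gcongr

/-- The wedge `|Im z| ≤ Re z`, without the origin. -/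
def wedge : Set ℂ := {z | 0 < z.re ∧ |z.im| ≤ z.re}

open Filter MeasureTheory Topology in
/-- Dominated convergence for Cauchy's integral at the saddle point `z = t = N / n`, in the scale
`z = (N / n) (1 - i v / √N)` and cut off to the circle. -/
theorem tendsto_integral_saddle {G : ℂ → ℂ} {A κ K t₀ : ℝ} {l : ℂ}
    (hA : 0 < A) (hκ : 0 < κ) (hK : 0 ≤ K) (ht₀ : 0 < t₀)
    (hcont : ContinuousOn G (Metric.ball 0 1))
    (hlim : Tendsto (fun z : ℂ => G (Complex.exp (-z)) * Complex.exp (-(A / z))) (𝓝[wedge] 0) (𝓝 l))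
    (hbd : ∀ t θ : ℝ, 0 < t → t ≤ t₀ → |θ| ≤ Real.pi →
      ‖G (Complex.exp (-(t - θ * Complex.I)))‖ ≤
        K * Real.exp (A / t - κ / t * min 1 ((θ / t) ^ 2)))
    {t N : ℕ → ℝ} (ht : ∀ᶠ n in atTop, 0 < t n) (ht0 : Tendsto t atTop (𝓝 0))
    (hNt : ∀ᶠ n in atTop, N n * t n = A) (hnt : ∀ᶠ n : ℕ in atTop, n * t n = N n)
    (hNtop : Tendsto N atTop atTop) :
    Tendsto (fun n : ℕ => ∫ v in (-(Real.pi * √(N n) / t n))..(Real.pi * √(N n) / t n),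
        G (Complex.exp (-(t n - (t n / √(N n) * v : ℝ) * Complex.I))) *
          Complex.exp (n * (t n - (t n / √(N n) * v : ℝ) * Complex.I) - 2 * N n))
      atTop (𝓝 (l * √Real.pi)) := by
  set f : ℕ → ℝ → ℂ := fun n v =>
    G (Complex.exp (-(t n - (t n / √(N n) * v : ℝ) * Complex.I))) *
          Complex.exp (n * (t n - (t n / √(N n) * v : ℝ) * Complex.I) - 2 * N n) with hf
  have hNpos : ∀ᶠ n in atTop, 0 < N n := hNtop.eventually_gt_atTop 0
  have hgauss : ∫ v : ℝ, l * (Real.exp (-v ^ 2) : ℂ) = l * √Real.pi := by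
    rw [integral_const_mul, integral_complex_ofReal]
    have := integral_gaussian 1
    simp only [neg_mul, one_mul, div_one] at this
    rw [this]
  rw [← hgauss]
  set S : ℕ → Set ℝ := fun n => Set.Ioc (-(Real.pi * √(N n) / t n)) (Real.pi * √(N n) / t n)
  have hcongr : ∀ᶠ n in atTop, ∫ v, (S n).indicator (f n) v =
      ∫ v in (-(Real.pi * √(N n) / t n))..(Real.pi * √(N n) / t n), f n v := by
    filter_upwards [ht] with n hn
    have : 0 ≤ Real.pi * √(N n) / t n := by positivity
    rw [integral_indicator measurableSet_Ioc, intervalIntegral.integral_of_le (by linarith)]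
  refine Tendsto.congr' hcongr ?_
  -- The exponential gain is `s = min (N, v ^ 2)`. On the circle `v ^ 2 = O(N ^ 3)`, hence
  -- `1 + v ^ 2 = O((1 + s) ^ 3)`, and `1 / (1 + v ^ 2)` serves as dominating function.
  obtain ⟨C, hC, hexp⟩ := exp_neg_mul_le_div_one_add_pow_three (κ := κ / A) (by positivity)
  set B : ℝ := 1 + Real.pi ^ 2 / A ^ 2 with hB
  refine tendsto_integral_filter_of_dominated_convergence
    (fun v => K * (C * B) * (1 + v ^ 2)⁻¹) ?_ ?_ (integrable_inv_one_add_sq.const_mul _) ?_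
  · filter_upwards [ht] with n hn
    refine AEStronglyMeasurable.indicator (Continuous.aestronglyMeasurable ?_) measurableSet_Ioc
    refine Continuous.mul (hcont.comp_continuous (by fun_prop) fun v => ?_) (by fun_prop)
    simp [Complex.norm_exp, hn]
  · filter_upwards [ht, hNpos, hNt, hnt, ht0.eventually_le_const ht₀] with n h1 h2 h3 h4 h5
    refine ae_of_all _ fun v => ?_
    by_cases hv : v ∈ S n
    · rw [Set.indicator_of_mem hv]
      set T := t n
      set M := N n
      have hsq : √M ^ 2 = M := Real.sq_sqrt h2.le
      have hs : 0 < √M := Real.sqrt_pos.mpr h2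
      have hv' : |v| ≤ Real.pi * √M / T := abs_le.mpr ⟨hv.1.le, hv.2⟩
      have hθ : |T / √M * v| ≤ Real.pi := by
        rw [abs_mul, abs_of_pos (div_pos h1 hs)]
        calc T / √M * |v| ≤ T / √M * (Real.pi * √M / T) := by gcongr
          _ = Real.pi := by field_simp
      have hAT : A / T = M := by rw [← h3]; field_simp
      have e1 : ((T / √M * v) / T) ^ 2 = v ^ 2 / M := by
        rw [div_pow, mul_pow, div_pow, hsq]; field_simp
      have e2 : κ / T * min 1 (v ^ 2 / M) = κ / A * min M (v ^ 2) := by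
        have : min M (v ^ 2) = M * min 1 (v ^ 2 / M) := by
          rw [mul_min_of_nonneg _ _ h2.le, mul_one, mul_div_cancel₀ _ h2.ne']
        rw [this, ← h3]; field_simp
      set s := min M (v ^ 2) with hs'
      have hs0 : 0 ≤ s := le_min h2.le (sq_nonneg v)
      have hn2 : ‖Complex.exp (n * (T - (T / √M * v : ℝ) * Complex.I) - 2 * M)‖ =
          Real.exp (-M) := by
        rw [Complex.norm_exp]
        congr 1
        simp
        rw [h4]; ring
      have h6 : 1 + v ^ 2 ≤ B * (1 + s) ^ 3 := by
        have hBs : 1 ≤ B := by rw [hB]; linarith [show 0 ≤ Real.pi ^ 2 / A ^ 2 by positivity]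
        rcases le_total (v ^ 2) M with h | h
        · rw [hs', min_eq_right h]
          calc 1 + v ^ 2 ≤ (1 + v ^ 2) ^ 3 := le_self_pow₀ (by nlinarith) (by norm_num)
            _ ≤ B * (1 + v ^ 2) ^ 3 := le_mul_of_one_le_left (by positivity) hBs
        · rw [hs', min_eq_left h]
          have : v ^ 2 ≤ Real.pi ^ 2 / A ^ 2 * M ^ 3 := by
            calc v ^ 2 = |v| ^ 2 := (sq_abs v).symm
              _ ≤ (Real.pi * √M / T) ^ 2 := by gcongr
              _ = Real.pi ^ 2 / A ^ 2 * M ^ 3 := by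
                rw [div_pow, mul_pow, hsq, ← h3]; field_simp
          have h7 : M ^ 3 ≤ (1 + M) ^ 3 := by gcongr; linarith
          have h8 : 1 ≤ (1 + M) ^ 3 := one_le_pow₀ (by linarith)
          calc 1 + v ^ 2 ≤ (1 + M) ^ 3 + Real.pi ^ 2 / A ^ 2 * (1 + M) ^ 3 := by
                  have : Real.pi ^ 2 / A ^ 2 * M ^ 3 ≤ Real.pi ^ 2 / A ^ 2 * (1 + M) ^ 3 := by
                    gcongr
                  linarith
            _ = _ := by rw [hB]; ring
      calc ‖f n v‖ ≤ K * Real.exp (A / T - κ / T * min 1 (((T / √M * v) / T) ^ 2)) *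
              Real.exp (-M) := by
            rw [hf, norm_mul, hn2]
            gcongr
            exact hbd T _ h1 h5 hθ
        _ = K * Real.exp (-(κ / A * s)) := by
            rw [e1, e2, hAT, mul_assoc, ← Real.exp_add]; congr 2; ring
        _ ≤ K * (C / (1 + s) ^ 3) := by gcongr; exact hexp s hs0
        _ ≤ K * (C * B * (1 + v ^ 2)⁻¹) := by
            gcongr
            rw [← div_eq_mul_inv, div_le_div_iff₀ (by positivity) (by positivity)]
            calc C * (1 + v ^ 2) ≤ C * (B * (1 + s) ^ 3) := by gcongr
              _ = _ := by ring
        _ = _ := by ring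
    · rw [Set.indicator_of_notMem hv, norm_zero]; positivity
  · refine ae_of_all _ fun v => ?_
    have hsqrt : Tendsto (fun n => √(N n)) atTop atTop := Real.tendsto_sqrt_atTop.comp hNtop
    have hvs : Tendsto (fun n => v / √(N n)) atTop (𝓝 0) := hsqrt.const_div_atTop v
    have hw : Tendsto (fun n => 1 - ((v / √(N n) : ℝ) : ℂ) * Complex.I) atTop (𝓝 1) := by
      have : Tendsto (fun n => 1 - ((v / √(N n) : ℝ) : ℂ) * Complex.I) atTop
          (𝓝 (1 - ((0 : ℝ) : ℂ) * Complex.I)) :=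
        tendsto_const_nhds.sub (((Complex.continuous_ofReal.tendsto 0).comp hvs).mul_const _)
      simpa using this
    have hz : Tendsto (fun n => (t n : ℂ) - (t n / √(N n) * v : ℝ) * Complex.I) atTop
        (𝓝[wedge] 0) := by
      refine tendsto_nhdsWithin_iff.mpr ⟨?_, ?_⟩
      · have h1 : Tendsto (fun n => (t n : ℂ) * (1 - ((v / √(N n) : ℝ) : ℂ) * Complex.I)) atTop
            (𝓝 (((0 : ℝ) : ℂ) * 1)) :=
          ((Complex.continuous_ofReal.tendsto 0).comp ht0).mul hw
        rw [Complex.ofReal_zero, zero_mul] at h1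
        refine h1.congr fun n => ?_
        push_cast; ring
      · have habs : Tendsto (fun n => |v / √(N n)|) atTop (𝓝 0) := by simpa using hvs.abs
        filter_upwards [ht, habs.eventually_le_const one_pos] with n h1 h2
        refine ⟨by simpa using h1, ?_⟩
        have : |t n / √(N n) * v| ≤ t n := by
          rw [show t n / √(N n) * v = t n * (v / √(N n)) by ring, abs_mul, abs_of_pos h1]
          exact mul_le_of_le_one_right h1.le h2
        simpa using this
    have hE : Tendsto (fun n => Complex.exp (-(v ^ 2 / (1 - ((v / √(N n) : ℝ) : ℂ) * Complex.I))))
        atTop (𝓝 (Real.exp (-v ^ 2) : ℂ)) := by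
      have : Tendsto (fun n => Complex.exp (-((v : ℂ) ^ 2 /
          (1 - ((v / √(N n) : ℝ) : ℂ) * Complex.I)))) atTop
          (𝓝 (Complex.exp (-((v : ℂ) ^ 2 / 1)))) :=
        (Complex.continuous_exp.tendsto _).comp ((tendsto_const_nhds.div hw one_ne_zero).neg)
      simpa using this
    refine ((hlim.comp hz).mul hE).congr' ?_
    have hwin : Tendsto (fun n => Real.pi * √(N n) / t n) atTop atTop := by
      have h1 : Tendsto (fun n => (t n)⁻¹) atTop atTop :=
        tendsto_inv_nhdsGT_zero.comp (tendsto_nhdsWithin_iff.mpr ⟨ht0, ht⟩)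
      exact (Tendsto.const_mul_atTop Real.pi_pos hsqrt).atTop_mul_atTop₀ h1
    filter_upwards [ht, hNpos, hNt, hnt, hwin.eventually_gt_atTop |v|] with n h1 h2 h3 h4 h5
    have hv : v ∈ S n := ⟨(abs_lt.mp h5).1, (abs_lt.mp h5).2.le⟩
    rw [Set.indicator_of_mem hv, hf]
    simp only [Function.comp]
    rw [mul_assoc, ← Complex.exp_add]
    congr 2
    have hsq : ((√(N n) : ℝ) : ℂ) ^ 2 = N n := by
      rw [← Complex.ofReal_pow, Real.sq_sqrt h2.le]
    have hs : ((√(N n) : ℝ) : ℂ) ≠ 0 := Complex.ofReal_ne_zero.mpr (Real.sqrt_pos.mpr h2).ne'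
    have hT : (t n : ℂ) ≠ 0 := Complex.ofReal_ne_zero.mpr h1.ne'
    set w : ℂ := 1 - ((v / √(N n) : ℝ) : ℂ) * Complex.I with hwdef
    have hw0 : w ≠ 0 := by
      intro h
      have := congrArg Complex.re h
      simp [hwdef] at this
    have hzw : (t n : ℂ) - (t n / √(N n) * v : ℝ) * Complex.I = t n * w := by
      rw [hwdef]; push_cast; ring
    have h3' : (N n : ℂ) * t n = A := by exact_mod_cast h3
    have h4' : (n : ℂ) * t n = N n := by exact_mod_cast h4
    have hAz : (A : ℂ) / (t n * w) = N n / w := by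
      rw [← h3']; field_simp
    -- In terms of `w` the exponent is `N (w + 1 / w - 2) = N (w - 1) ^ 2 / w = -v ^ 2 / w`.
    have hv2 : (v : ℂ) ^ 2 = -(N n * (w - 1) ^ 2) := by
      rw [hwdef, ← hsq]; push_cast; field_simp
      linear_combination (v : ℂ) ^ 2 * Complex.I_sq
    rw [hzw, hAz, hv2, ← mul_assoc, h4']
    field_simp
    ring

open Filter MeasureTheory Topology in
/-- If `G (e ^ (-z)) ~ l e ^ (A / z)` as `z → 0` near the positive axis, and `G` is smaller than
this away from the axis, then the Taylor coefficients of `G` have the asymptotics which the saddle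
point `z = √(A / n)` predicts. -/
theorem isEquivalent_coeff_of_saddle {G : ℂ → ℂ} {c : ℕ → ℝ} {A κ K t₀ l : ℝ}
    (hA : 0 < A) (hκ : 0 < κ) (hK : 0 ≤ K) (ht₀ : 0 < t₀) (hl : l ≠ 0)
    (hcont : ContinuousOn G (Metric.ball 0 1))
    (hcoef : ∀ t : ℝ, 0 < t → ∀ n : ℕ, (2 * Real.pi * c n : ℂ) =
      ∫ θ in (-Real.pi)..Real.pi,
        G (Complex.exp (-(t - θ * Complex.I))) * Complex.exp (n * (t - θ * Complex.I)))
    (hlim : Tendsto (fun z : ℂ => G (Complex.exp (-z)) * Complex.exp (-(A / z)))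
      (𝓝[wedge] 0) (𝓝 (l : ℂ)))
    (hbd : ∀ t θ : ℝ, 0 < t → t ≤ t₀ → |θ| ≤ Real.pi →
      ‖G (Complex.exp (-(t - θ * Complex.I)))‖ ≤
        K * Real.exp (A / t - κ / t * min 1 ((θ / t) ^ 2))) :
    Asymptotics.IsEquivalent atTop c (fun n : ℕ =>
      l * A ^ (1 / 4 : ℝ) / (2 * √Real.pi * (n : ℝ) ^ (3 / 4 : ℝ)) * Real.exp (2 * √(A * n))) := by
  set t : ℕ → ℝ := fun n => √(A / n) with htdef
  set N : ℕ → ℝ := fun n => √(A * n) with hNdef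
  have hcast : Tendsto (fun n : ℕ => (n : ℝ)) atTop atTop := tendsto_natCast_atTop_atTop
  have ht : ∀ᶠ n in atTop, 0 < t n := by
    filter_upwards [eventually_gt_atTop 0] with n hn
    have : (0 : ℝ) < n := by exact_mod_cast hn
    exact Real.sqrt_pos.mpr (by positivity)
  have ht0 : Tendsto t atTop (𝓝 0) := by
    have := (Real.continuous_sqrt.tendsto 0).comp (hcast.const_div_atTop A)
    rwa [Real.sqrt_zero] at this
  have hNtop : Tendsto N atTop atTop :=
    Real.tendsto_sqrt_atTop.comp (Tendsto.const_mul_atTop hA hcast)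
  have hNt : ∀ᶠ n in atTop, N n * t n = A := by
    filter_upwards [eventually_gt_atTop 0] with n hn
    have : (0 : ℝ) < n := by exact_mod_cast hn
    rw [hNdef, htdef]
    simp only
    rw [← Real.sqrt_mul (by positivity), show A * n * (A / n) = A ^ 2 by field_simp,
      Real.sqrt_sq hA.le]
  have hnt : ∀ᶠ n : ℕ in atTop, n * t n = N n := by
    filter_upwards [eventually_gt_atTop 0] with n hn
    have : (0 : ℝ) < n := by exact_mod_cast hn
    rw [hNdef, htdef]
    simp only
    rw [show A * (n : ℝ) = n ^ 2 * (A / n) by field_simp, Real.sqrt_mul (by positivity),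
      Real.sqrt_sq this.le]
  have hlimI := tendsto_integral_saddle hA hκ hK ht₀ hcont hlim hbd ht ht0 hNt hnt hNtop
  have hre := (Complex.continuous_re.tendsto _).comp hlimI
  have hpi : √Real.pi ≠ 0 := (Real.sqrt_pos.mpr Real.pi_pos).ne'
  have hquot := hre.div_const (l * √Real.pi)
  rw [← Complex.ofReal_mul, Complex.ofReal_re, div_self (mul_ne_zero hl hpi)] at hquot
  refine Asymptotics.isEquivalent_of_tendsto_one (hquot.congr' ?_)
  filter_upwards [ht, hNt, hnt, hNtop.eventually_gt_atTop 0, eventually_gt_atTop 0]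
    with n h1 h2 h3 h4 h5
  have hn : (0 : ℝ) < n := by exact_mod_cast h5
  have hs : 0 < √(N n) := Real.sqrt_pos.mpr h4
  have hscale : t n / √(N n) = A ^ (1 / 4 : ℝ) / (n : ℝ) ^ (3 / 4 : ℝ) := by
    rw [hNdef, htdef]
    simp only
    rw [Real.sqrt_eq_rpow, Real.sqrt_eq_rpow, Real.sqrt_eq_rpow, ← Real.rpow_mul (by positivity),
      Real.div_rpow hA.le hn.le, Real.mul_rpow hA.le hn.le, div_div, div_eq_div_iff
        (by positivity) (by positivity), show (1 / 2 : ℝ) = 1 / 4 + 1 / 2 * (1 / 2) by norm_num,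
      show (3 / 4 : ℝ) = (1 / 4 + 1 / 2 * (1 / 2)) + 1 / 2 * (1 / 2) by norm_num,
      Real.rpow_add hA, Real.rpow_add hn, Real.rpow_add hn]
    norm_num
    ring
  have hint : (2 * Real.pi * c n : ℂ) * Complex.exp (-(2 * N n)) =
      (t n / √(N n) : ℝ) * ∫ v in (-(Real.pi * √(N n) / t n))..(Real.pi * √(N n) / t n),
        G (Complex.exp (-(t n - (t n / √(N n) * v : ℝ) * Complex.I))) *
          Complex.exp (n * (t n - (t n / √(N n) * v : ℝ) * Complex.I) - 2 * N n) := by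
    have hb : t n / √(N n) * (Real.pi * √(N n) / t n) = Real.pi := by field_simp
    have := intervalIntegral.smul_integral_comp_mul_left (a := -(Real.pi * √(N n) / t n))
      (b := Real.pi * √(N n) / t n) (fun θ : ℝ => G (Complex.exp (-(t n - θ * Complex.I))) *
          Complex.exp (n * (t n - θ * Complex.I) - 2 * N n)) (t n / √(N n))
    rw [mul_neg, hb, Complex.real_smul] at this
    rw [this, hcoef (t n) h1 n, ← intervalIntegral.integral_mul_const]
    refine intervalIntegral.integral_congr fun θ _ => ?_
    rw [mul_assoc, ← Complex.exp_add, sub_eq_add_neg (n * _ : ℂ)]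
  have hI : ((2 * Real.pi * c n * Real.exp (-(2 * N n)) / (t n / √(N n)) : ℝ) : ℂ) =
      ∫ v in (-(Real.pi * √(N n) / t n))..(Real.pi * √(N n) / t n),
        G (Complex.exp (-(t n - (t n / √(N n) * v : ℝ) * Complex.I))) *
          Complex.exp (n * (t n - (t n / √(N n) * v : ℝ) * Complex.I) - 2 * N n) := by
    have hne : ((t n / √(N n) : ℝ) : ℂ) ≠ 0 := Complex.ofReal_ne_zero.mpr (by positivity)
    rw [Complex.ofReal_div, div_eq_iff hne, mul_comm _ ((t n / √(N n) : ℝ) : ℂ), ← hint]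
    push_cast
    rfl
  simp only [Function.comp, Pi.div_apply]
  rw [← hI, Complex.ofReal_re, hscale, Real.exp_neg]
  have hNn : √(A * n) = N n := rfl
  rw [hNn]
  have hA4 : 0 < A ^ (1 / 4 : ℝ) := by positivity
  have hn4 : 0 < (n : ℝ) ^ (3 / 4 : ℝ) := by positivity
  field_simp
  rw [Real.sq_sqrt Real.pi_pos.le, mul_comm]

/-! ### Euler's product and its behaviour at the cusp `q = 1` -/

/-- Euler's product `∏_{k ≥ 1} (1 - q ^ k)`, for `|q| < 1`. -/
noncomputable def eulerProd (q : ℂ) : ℂ := ∏' n : ℕ, (1 - q ^ (n + 1))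

theorem summable_norm_pow_succ {q : ℂ} (hq : ‖q‖ < 1) : Summable fun n : ℕ => ‖q ^ (n + 1)‖ := by
  simpa using (summable_nat_add_iff 1).mpr (summable_geometric_of_lt_one (norm_nonneg _) hq)

theorem one_sub_pow_ne_zero {q : ℂ} (hq : ‖q‖ < 1) {n : ℕ} (hn : n ≠ 0) : 1 - q ^ n ≠ 0 := by
  intro h
  have h1 : ‖q ^ n‖ = 1 := by rw [← sub_eq_zero.mp h, norm_one]
  rw [norm_pow] at h1
  exact (pow_lt_one₀ (norm_nonneg q) hq hn).ne h1

theorem eulerProd_ne_zero {q : ℂ} (hq : ‖q‖ < 1) : eulerProd q ≠ 0 := by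
  simp only [eulerProd, sub_eq_add_neg]
  refine tprod_one_add_ne_zero_of_summable (fun i => ?_) (by simpa using summable_norm_pow_succ hq)
  rw [← sub_eq_add_neg]
  exact one_sub_pow_ne_zero hq i.succ_ne_zero

theorem continuousOn_eulerProd : ContinuousOn eulerProd (Metric.ball 0 1) :=
  ModularForm.differentiableOn_tprod_one_sub_pow.continuousOn

theorem tendsto_eulerProd_zero : Filter.Tendsto eulerProd (nhds 0) (nhds 1) := by
  have h := continuousOn_eulerProd.continuousAt (Metric.ball_mem_nhds (0 : ℂ) one_pos)
  have h0 : eulerProd 0 = 1 := by simp [eulerProd]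
  simpa [ContinuousAt, h0] using h

/-- The eta function in the variable `q = e ^ (-z)`, that is at `τ = i z / 2π`. -/
theorem eta_I_mul_div (z : ℂ) :
    ModularForm.eta (Complex.I * z / (2 * Real.pi)) =
      Complex.exp (-z / 24) * eulerProd (Complex.exp (-z)) := by
  have hpi : (Real.pi : ℂ) ≠ 0 := Complex.ofReal_ne_zero.mpr Real.pi_ne_zero
  have h : ∀ h : ℂ, 2 * Real.pi * Complex.I * (Complex.I * z / (2 * Real.pi)) / h = -z / h := by
    intro h
    rw [show 2 * Real.pi * Complex.I * (Complex.I * z / (2 * Real.pi)) =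
      Complex.I ^ 2 * z by field_simp, Complex.I_sq, neg_one_mul]
  simp only [ModularForm.eta, ModularForm.eta_q, Function.Periodic.qParam, eulerProd, h]
  norm_num

/-- The factor `√i / √(i z / 2π)`, which occurs in the transformation of `η` with weight `1 / 2`
and cancels in quotients of weight `0`. -/
noncomputable def etaFactor (z : ℂ) : ℂ :=
  Complex.sqrt Complex.I / Complex.sqrt (Complex.I * z / (2 * Real.pi))

theorem csqrt_ne_zero {z : ℂ} (hz : z ≠ 0) : Complex.sqrt z ≠ 0 := by
  rw [sqrt_eq_exp hz]; exact Complex.exp_ne_zero _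

theorem I_mul_div_two_pi_ne_zero {z : ℂ} (hz : z ≠ 0) : Complex.I * z / (2 * Real.pi) ≠ 0 := by
  have hpi : (Real.pi : ℂ) ≠ 0 := Complex.ofReal_ne_zero.mpr Real.pi_ne_zero
  exact div_ne_zero (mul_ne_zero Complex.I_ne_zero hz) (mul_ne_zero two_ne_zero hpi)

theorem etaFactor_ne_zero {z : ℂ} (hz : z ≠ 0) : etaFactor z ≠ 0 :=
  div_ne_zero (csqrt_ne_zero Complex.I_ne_zero) (csqrt_ne_zero (I_mul_div_two_pi_ne_zero hz))

theorem csqrt_real_mul {d : ℝ} (hd : 0 < d) {z : ℂ} (hz : z ≠ 0) :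
    Complex.sqrt (d * z) = √d * Complex.sqrt z := by
  have hd' : (d : ℂ) ≠ 0 := Complex.ofReal_ne_zero.mpr hd.ne'
  rw [sqrt_eq_exp (mul_ne_zero hd' hz), sqrt_eq_exp hz,
    Complex.log_ofReal_mul hd hz, ← Real.exp_log (Real.sqrt_pos.mpr hd), Complex.ofReal_exp,
    ← Complex.exp_add, Real.log_sqrt hd.le]
  congr 1
  push_cast
  ring

/-- The transformation `z ↦ 4 π² / z` of Euler's product at `q = e ^ (-d z)`. -/
theorem eulerProd_exp_neg_mul {d : ℝ} (hd : 0 < d) {z : ℂ} (hz : 0 < z.re) :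
    eulerProd (Complex.exp (-(d * z))) * Complex.exp (Real.pi ^ 2 / (6 * d * z)) / etaFactor z =
      (1 / √d : ℝ) * Complex.exp (d * z / 24) *
        eulerProd (Complex.exp (-(4 * Real.pi ^ 2 / (d * z)))) := by
  have hz0 : z ≠ 0 := by rintro rfl; simp at hz
  have hd' : (d : ℂ) ≠ 0 := Complex.ofReal_ne_zero.mpr hd.ne'
  have hpi : (Real.pi : ℂ) ≠ 0 := Complex.ofReal_ne_zero.mpr Real.pi_ne_zero
  set τ : ℂ := Complex.I * (d * z) / (2 * Real.pi) with hτ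
  have hτ_im : τ ∈ UpperHalfPlane.upperHalfPlaneSet := by
    have : τ = ((d / (2 * Real.pi) : ℝ) : ℂ) * (Complex.I * z) := by
      rw [hτ]; push_cast; ring
    show 0 < τ.im
    rw [this, Complex.im_ofReal_mul]
    simp only [Complex.I_mul_im]
    positivity
  have hinv : -1 / τ = Complex.I * (4 * Real.pi ^ 2 / (d * z)) / (2 * Real.pi) := by
    rw [hτ]
    field_simp
    linear_combination (-4 : ℂ) * Complex.I_sq
  have key := ModularForm.eta_comp_eq_csqrt_I_inv hτ_im
  simp only [Function.comp, Pi.smul_apply, Pi.mul_apply, smul_eq_mul] at key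
  have hsq : Complex.sqrt τ = √d * Complex.sqrt (Complex.I * z / (2 * Real.pi)) := by
    rw [← csqrt_real_mul hd (I_mul_div_two_pi_ne_zero hz0), hτ]
    congr 1; ring
  rw [hinv, eta_I_mul_div, hsq, hτ, eta_I_mul_div] at key
  have h1 := csqrt_ne_zero Complex.I_ne_zero
  have h2 := csqrt_ne_zero (I_mul_div_two_pi_ne_zero hz0)
  have h3 : ((√d : ℝ) : ℂ) ≠ 0 := Complex.ofReal_ne_zero.mpr (Real.sqrt_pos.mpr hd).ne'
  have e1 : Complex.exp (-(4 * Real.pi ^ 2 / (d * z)) / 24) =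
      (Complex.exp (Real.pi ^ 2 / (6 * d * z)))⁻¹ := by
    rw [← Complex.exp_neg]; congr 1; field_simp; norm_num
  have e2 : Complex.exp (-(d * z) / 24) = (Complex.exp (d * z / 24))⁻¹ := by
    rw [← Complex.exp_neg]; congr 1; ring
  rw [e1, e2] at key
  have h4 := Complex.exp_ne_zero (Real.pi ^ 2 / (6 * d * z))
  have h5 := Complex.exp_ne_zero (d * z / 24)
  rw [etaFactor]
  push_cast
  field_simp at key ⊢
  linear_combination -key

open Filter Topology in
theorem tendsto_re_div_wedge {a : ℝ} (ha : 0 < a) :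
    Tendsto (fun z : ℂ => ((a : ℂ) / z).re) (𝓝[wedge] 0) atTop := by
  have h1 : Tendsto (fun z : ℂ => ‖z‖) (𝓝[wedge] 0) (𝓝[>] 0) := by
    refine tendsto_nhdsWithin_iff.mpr ⟨?_, ?_⟩
    · simpa using (continuous_norm.tendsto (0 : ℂ)).mono_left nhdsWithin_le_nhds
    · filter_upwards [self_mem_nhdsWithin] with z hz
      exact norm_pos_iff.mpr fun h => by simp [h, wedge] at hz
  have h2 := (tendsto_inv_nhdsGT_zero.comp h1).const_mul_atTop (show 0 < a / 2 by positivity)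
  refine tendsto_atTop_mono' _ ?_ h2
  filter_upwards [self_mem_nhdsWithin] with z hz
  have hz0 : 0 < ‖z‖ := norm_pos_iff.mpr fun h => by simp [h, wedge] at hz
  have h3 : ‖z‖ ≤ 2 * z.re := by
    have := Complex.norm_le_abs_re_add_abs_im z
    rw [abs_of_pos hz.1] at this
    linarith [hz.2]
  have h4 : ((a : ℂ) / z).re = a * z.re / ‖z‖ ^ 2 := by
    rw [Complex.div_re, Complex.normSq_eq_norm_sq]; simp
  simp only [Function.comp]
  rw [h4, ← div_eq_mul_inv, div_div, div_le_div_iff₀ (by positivity) (by positivity)]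
  nlinarith [mul_nonneg ha.le hz0.le, mul_le_mul_of_nonneg_left h3 (mul_nonneg ha.le hz0.le)]

open Filter Topology in
/-- The growth of Euler's product at `q = 1`, with `q ↦ q ^ d` taken into account. -/
theorem tendsto_eulerProd_wedge {d : ℝ} (hd : 0 < d) :
    Tendsto (fun z : ℂ => eulerProd (Complex.exp (-(d * z))) *
        Complex.exp (Real.pi ^ 2 / (6 * d * z)) / etaFactor z)
      (𝓝[wedge] 0) (𝓝 ((1 / √d : ℝ) : ℂ)) := by
  have h1 : Tendsto (fun z : ℂ => Complex.exp (-(4 * Real.pi ^ 2 / (d * z)))) (𝓝[wedge] 0)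
      (𝓝 0) := by
    rw [tendsto_zero_iff_norm_tendsto_zero]
    have := tendsto_re_div_wedge (show 0 < 4 * Real.pi ^ 2 / d by positivity)
    refine (Real.tendsto_exp_neg_atTop_nhds_zero.comp this).congr fun z => ?_
    simp only [Function.comp, Complex.norm_exp, Complex.neg_re]
    congr 3
    push_cast
    rw [div_div]
  have h2 : Tendsto (fun z : ℂ => Complex.exp (d * z / 24)) (𝓝[wedge] 0) (𝓝 1) := by
    have : Continuous fun z : ℂ => Complex.exp (d * z / 24) := by fun_prop
    simpa using (this.tendsto 0).mono_left nhdsWithin_le_nhds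
  have h3 := (h2.const_mul ((1 / √d : ℝ) : ℂ)).mul (tendsto_eulerProd_zero.comp h1)
  rw [mul_one, mul_one] at h3
  refine h3.congr' ?_
  filter_upwards [self_mem_nhdsWithin] with z hz
  exact (eulerProd_exp_neg_mul hd hz.1).symm

open Filter Topology in
/-- The weight factors cancel in `(E(q ^ m) / E(q)) ^ h`. -/
theorem tendsto_regular_wedge {m h : ℕ} (hm : 0 < m) :
    Tendsto (fun z : ℂ =>
        (eulerProd (Complex.exp (-z) ^ m) / eulerProd (Complex.exp (-z))) ^ h *
          Complex.exp (-((Real.pi ^ 2 * h * (m - 1) / (6 * m) : ℝ) / z)))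
      (𝓝[wedge] 0) (𝓝 (((1 / √m) ^ h : ℝ) : ℂ)) := by
  have hm' : (0 : ℝ) < m := by exact_mod_cast hm
  have h1 := ((tendsto_eulerProd_wedge hm').div (tendsto_eulerProd_wedge one_pos)
    (by norm_num)).pow h
  have hlim : (((1 / √m) ^ h : ℝ) : ℂ) =
      (((1 / √(m : ℝ) : ℝ) : ℂ) / ((1 / √(1 : ℝ) : ℝ) : ℂ)) ^ h := by
    push_cast; simp
  rw [hlim]
  refine h1.congr' ?_
  filter_upwards [self_mem_nhdsWithin] with z hz
  have hz0 : z ≠ 0 := by rintro rfl; simp [wedge] at hz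
  have hS := etaFactor_ne_zero hz0
  have hmC : (m : ℂ) ≠ 0 := by exact_mod_cast hm.ne'
  have hexp : Complex.exp (-((Real.pi ^ 2 * h * (m - 1) / (6 * m) : ℝ) / z)) =
      (Complex.exp (Real.pi ^ 2 / (6 * m * z)) / Complex.exp (Real.pi ^ 2 / (6 * z))) ^ h := by
    rw [← Complex.exp_sub, ← Complex.exp_nat_mul]
    congr 1; push_cast; field_simp; ring
  have he := Complex.exp_ne_zero (Real.pi ^ 2 / (6 * z))
  rw [hexp, ← mul_pow, ← Complex.exp_nat_mul]
  simp only [Complex.ofReal_one, one_mul, mul_one, Complex.ofReal_natCast, mul_neg]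
  congr 1
  simp only [Pi.div_apply]
  rw [div_div_div_cancel_right₀ hS, mul_div_mul_comm]

theorem mul_add_one_injective {m : ℕ} (hm : 0 < m) : Function.Injective fun j : ℕ => m * j + 1 := by
  intro a b h
  exact Nat.eq_of_mul_eq_mul_left hm (by simpa using h)

/-- `∏_{k odd} (1 + x ^ k)`. -/
noncomputable def oddProd (x : ℂ) : ℂ := ∏' j : ℕ, (1 + x ^ (2 * j + 1))

theorem summable_norm_pow_odd {x : ℂ} (hx : ‖x‖ < 1) : Summable fun j : ℕ => ‖x ^ (2 * j + 1)‖ :=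
  (summable_norm_geometric_of_norm_lt_one hx).comp_injective (mul_add_one_injective two_pos)

theorem multipliable_one_add_pow_odd {x : ℂ} (hx : ‖x‖ < 1) :
    Multipliable fun j : ℕ => (1 + x ^ (2 * j + 1)) :=
  multipliable_one_add_of_summable (summable_norm_pow_odd hx)

/-- The even-odd splitting `∏ (1 - (-x)^k) = ∏ (1 - x^(2k)) ∏ (1 + x^(2k-1))`. -/
theorem eulerProd_neg {x : ℂ} (hx : ‖x‖ < 1) :
    eulerProd (-x) = eulerProd (x ^ 2) * oddProd x := by
  have hx2 : ‖x ^ 2‖ < 1 := by rw [norm_pow]; exact pow_lt_one₀ (norm_nonneg _) hx two_ne_zero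
  have h1 := multipliable_one_add_pow_odd hx
  have h2 := ModularForm.multipliable_one_sub_pow hx2
  have e1 : ∀ k : ℕ, 1 - (-x) ^ (2 * k + 1) = 1 + x ^ (2 * k + 1) := fun k => by
    rw [Odd.neg_pow ⟨k, rfl⟩]; ring
  have e2 : ∀ k : ℕ, 1 - (-x) ^ (2 * k + 1 + 1) = 1 - (x ^ 2) ^ (k + 1) := fun k => by
    rw [Even.neg_pow ⟨k + 1, by ring⟩, ← pow_mul]; ring_nf
  have := tprod_even_mul_odd (f := fun n : ℕ => 1 - (-x) ^ (n + 1))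
    (by simpa only [e1] using h1) (by simpa only [e2] using h2)
  simp only [e1, e2] at this
  rw [eulerProd, ← this, mul_comm]; rfl

/-- Eliminating the products over odd indices from the splittings at `x`, `-x` and `-x ^ 2`. -/
theorem eulerProd_neg_mul {x : ℂ} (hx : ‖x‖ < 1) :
    eulerProd (-x) * (eulerProd x * eulerProd (x ^ 4)) = eulerProd (x ^ 2) ^ 3 := by
  have hx2 : ‖x ^ 2‖ < 1 := by rw [norm_pow]; exact pow_lt_one₀ (norm_nonneg _) hx two_ne_zero
  have hnx : ‖-x‖ < 1 := by rwa [norm_neg]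
  have h1 := eulerProd_neg hx
  have h2 := eulerProd_neg hnx
  rw [neg_neg, neg_sq] at h2
  have hnx2 : ‖-(x ^ 2)‖ < 1 := by rwa [norm_neg]
  have h3 := eulerProd_neg hnx2
  rw [neg_neg, neg_sq, ← pow_mul] at h3
  have h4 : oddProd x * oddProd (-x) = oddProd (-(x ^ 2)) := by
    rw [oddProd, oddProd, oddProd, ← (multipliable_one_add_pow_odd hx).tprod_mul
      (multipliable_one_add_pow_odd hnx)]
    refine tprod_congr fun j => ?_
    rw [Odd.neg_pow ⟨j, rfl⟩, Odd.neg_pow ⟨j, rfl⟩, ← pow_mul]; ring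
  rw [h1, h2]
  rw [← h4] at h3
  linear_combination (-eulerProd (x ^ 2) ^ 2) * h3

open Filter Topology in
/-- `E(-q ^ M) / E(q ^ 2) = E(q ^ (2 M)) ^ 3 / (E(q ^ M) E(q ^ (4 M)) E(q ^ 2))` has weight `0`. -/
theorem tendsto_odd_wedge {M : ℕ} (hM : 0 < M) :
    Tendsto (fun z : ℂ =>
        eulerProd (-(Complex.exp (-z) ^ M)) / eulerProd (Complex.exp (-z) ^ 2) *
          Complex.exp (-((Real.pi ^ 2 * (2 * M - 1) / (24 * M) : ℝ) / z)))
      (𝓝[wedge] 0) (𝓝 (((1 / √M) : ℝ) : ℂ)) := by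
  have hM' : (0 : ℝ) < M := by exact_mod_cast hM
  have hne : ∀ {d : ℝ}, 0 < d → ((1 / √d : ℝ) : ℂ) ≠ 0 := fun hd =>
    Complex.ofReal_ne_zero.mpr (one_div_ne_zero (Real.sqrt_pos.mpr hd).ne')
  have h1 := ((tendsto_eulerProd_wedge (show (0 : ℝ) < 2 * M by positivity)).pow 3).div
    (((tendsto_eulerProd_wedge hM').mul
      (tendsto_eulerProd_wedge (show (0 : ℝ) < 4 * M by positivity))).mul
      (tendsto_eulerProd_wedge two_pos))
    (mul_ne_zero (mul_ne_zero (hne hM') (hne (by positivity))) (hne two_pos))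
  have hlim : (((1 / √M) : ℝ) : ℂ) = ((1 / √(2 * M) : ℝ) : ℂ) ^ 3 /
      (((1 / √M : ℝ) : ℂ) * ((1 / √(4 * M) : ℝ) : ℂ) * ((1 / √2 : ℝ) : ℂ)) := by
    norm_cast
    have h4 : √(4 * (M : ℝ)) = 2 * √M := by
      rw [show (4 : ℝ) * M = 2 ^ 2 * M by ring, Real.sqrt_mul (by norm_num),
        Real.sqrt_sq (by norm_num)]
    have h2 : √(2 * (M : ℝ)) = √2 * √M := Real.sqrt_mul (by norm_num) _
    have h5 : √2 ^ 2 = (2 : ℝ) := Real.sq_sqrt (by norm_num)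
    have h6 : 0 < √(M : ℝ) := Real.sqrt_pos.mpr hM'
    have h7 : (0 : ℝ) < √2 := by positivity
    push_cast
    rw [h4, h2]
    field_simp
    rw [h5]
  rw [hlim]
  refine h1.congr' ?_
  filter_upwards [self_mem_nhdsWithin] with z hz
  have hz0 : z ≠ 0 := by rintro rfl; simp [wedge] at hz
  have hS := etaFactor_ne_zero hz0
  have hMC : (M : ℂ) ≠ 0 := by exact_mod_cast hM.ne'
  have hq : ‖Complex.exp (-z)‖ < 1 := by
    rw [Complex.norm_exp]; simpa using hz.1
  have hpow : ∀ {k : ℕ}, k ≠ 0 → ‖Complex.exp (-z) ^ k‖ < 1 := fun hk => by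
    rw [norm_pow]; exact pow_lt_one₀ (norm_nonneg _) hq hk
  have hneg := eulerProd_neg_mul (hpow hM.ne')
  have hexp : Complex.exp (-((Real.pi ^ 2 * (2 * M - 1) / (24 * M) : ℝ) / z)) =
      Complex.exp (Real.pi ^ 2 / (6 * (2 * M) * z)) ^ 3 /
        (Complex.exp (Real.pi ^ 2 / (6 * M * z)) * Complex.exp (Real.pi ^ 2 / (6 * (4 * M) * z)) *
          Complex.exp (Real.pi ^ 2 / (6 * 2 * z))) := by
    rw [← Complex.exp_nat_mul, ← Complex.exp_add, ← Complex.exp_add, ← Complex.exp_sub]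
    congr 1; push_cast; field_simp; ring
  have p1 : Complex.exp (-(M * z)) = Complex.exp (-z) ^ M := by
    rw [← Complex.exp_nat_mul]; congr 1; ring
  have p2 : Complex.exp (-(2 * M * z)) = (Complex.exp (-z) ^ M) ^ 2 := by
    rw [← p1, ← Complex.exp_nat_mul]; congr 1; push_cast; ring
  have p4 : Complex.exp (-(4 * M * z)) = (Complex.exp (-z) ^ M) ^ 4 := by
    rw [← p1, ← Complex.exp_nat_mul]; congr 1; push_cast; ring
  have p5 : Complex.exp (-(2 * z)) = Complex.exp (-z) ^ 2 := by
    rw [← Complex.exp_nat_mul]; congr 1; push_cast; ring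
  rw [hexp]
  simp only [Pi.div_apply]
  push_cast
  rw [p1, p2, p4, p5]
  have n1 := eulerProd_ne_zero (hpow hM.ne')
  have n4 : eulerProd ((Complex.exp (-z) ^ M) ^ 4) ≠ 0 := by
    rw [← pow_mul]; exact eulerProd_ne_zero (hpow (by omega))
  have n2 := eulerProd_ne_zero (hpow two_ne_zero)
  set x := Complex.exp (-z) ^ M
  have : eulerProd (-x) = eulerProd (x ^ 2) ^ 3 / (eulerProd x * eulerProd (x ^ 4)) := by
    rw [eq_div_iff (mul_ne_zero n1 n4)]; exact hneg
  rw [this]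
  have e1 := Complex.exp_ne_zero (Real.pi ^ 2 / (6 * M * z))
  have e2 := Complex.exp_ne_zero (Real.pi ^ 2 / (6 * (4 * M) * z))
  have e3 := Complex.exp_ne_zero (Real.pi ^ 2 / (6 * 2 * z))
  generalize Complex.exp (Real.pi ^ 2 / (6 * M * z)) = y1 at *
  generalize Complex.exp (Real.pi ^ 2 / (6 * (4 * M) * z)) = y2 at *
  generalize Complex.exp (Real.pi ^ 2 / (6 * 2 * z)) = y3 at *
  generalize Complex.exp (Real.pi ^ 2 / (6 * (2 * M) * z)) = y4 at *
  field_simp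

/-! ### Decay away from the positive axis -/

theorem norm_one_sub_sq (x : ℂ) : ‖1 - x‖ ^ 2 = (1 - ‖x‖) ^ 2 + 2 * (‖x‖ - x.re) := by
  have h := Complex.sq_norm x
  rw [Complex.normSq_apply] at h
  rw [Complex.sq_norm, Complex.normSq_apply, Complex.sub_re, Complex.sub_im, Complex.one_re,
    Complex.one_im]
  linear_combination -h

theorem norm_one_add_sq (x : ℂ) : ‖1 + x‖ ^ 2 = (1 + ‖x‖) ^ 2 - 2 * (‖x‖ - x.re) := by
  have := norm_one_sub_sq (-x)
  simp only [sub_neg_eq_add, norm_neg, Complex.neg_re] at this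
  rw [this]; ring

/-- From `|1 - x| ^ 2 = (1 - |x|) ^ 2 + 2 (|x| - Re x)` and `log y ≥ 1 - 1 / y`. -/
theorem le_log_norm_one_sub {x : ℂ} (hx : ‖x‖ < 1) :
    (‖x‖ - x.re) / 4 ≤ Real.log ‖1 - x‖ - Real.log (1 - ‖x‖) := by
  have h1 : 0 < 1 - ‖x‖ := by linarith
  have h2 : 0 < ‖1 - x‖ := norm_pos_iff.mpr fun h => by
    rw [← sub_eq_zero.mp h, norm_one] at hx; exact lt_irrefl _ hx
  have h3 : ‖1 - x‖ ≤ 2 := by have := norm_sub_le 1 x; rw [norm_one] at this; linarith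
  have h4 : 0 ≤ ‖x‖ - x.re := sub_nonneg.mpr (Complex.re_le_norm x)
  have h5 := Real.one_sub_inv_le_log_of_pos (show 0 < ‖1 - x‖ ^ 2 / (1 - ‖x‖) ^ 2 by positivity)
  rw [Real.log_div (by positivity) (by positivity), Real.log_pow, Real.log_pow, inv_div] at h5
  have h6 : 1 - (1 - ‖x‖) ^ 2 / ‖1 - x‖ ^ 2 = 2 * (‖x‖ - x.re) / ‖1 - x‖ ^ 2 := by
    rw [eq_div_iff (by positivity), sub_mul, div_mul_cancel₀ _ (by positivity), norm_one_sub_sq]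
    ring
  have h7 : 2 * (‖x‖ - x.re) / 4 ≤ 2 * (‖x‖ - x.re) / ‖1 - x‖ ^ 2 := by
    gcongr; nlinarith
  push_cast at h5
  linarith

theorem le_neg_log_norm_one_add {x : ℂ} (hx : ‖x‖ < 1) :
    (‖x‖ - x.re) / 4 ≤ Real.log (1 + ‖x‖) - Real.log ‖1 + x‖ := by
  have h1 : 0 < 1 + ‖x‖ := by positivity
  have h2 : 0 < ‖1 + x‖ := norm_pos_iff.mpr fun h => by
    rw [← norm_neg, ← eq_neg_of_add_eq_zero_left h, norm_one] at hx; exact lt_irrefl _ hx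
  have h4 : 0 ≤ ‖x‖ - x.re := sub_nonneg.mpr (Complex.re_le_norm x)
  have h5 := Real.one_sub_inv_le_log_of_pos (show 0 < (1 + ‖x‖) ^ 2 / ‖1 + x‖ ^ 2 by positivity)
  rw [Real.log_div (by positivity) (by positivity), Real.log_pow, Real.log_pow, inv_div] at h5
  have h6 : 1 - ‖1 + x‖ ^ 2 / (1 + ‖x‖) ^ 2 = 2 * (‖x‖ - x.re) / (1 + ‖x‖) ^ 2 := by
    rw [eq_div_iff (by positivity), sub_mul, div_mul_cancel₀ _ (by positivity), norm_one_add_sq]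
    ring
  have h7 : 2 * (‖x‖ - x.re) / 4 ≤ 2 * (‖x‖ - x.re) / (1 + ‖x‖) ^ 2 := by
    gcongr; nlinarith [norm_nonneg x]
  push_cast at h5
  linarith

/-- The gap `∑_{k ≡ 1 mod m} (|q| ^ k - Re q ^ k)`, which measures how far `q` is from the
positive axis. -/
noncomputable def circleGap (m : ℕ) (q : ℂ) : ℝ :=
  ∑' j : ℕ, (‖q‖ ^ (m * j + 1) - (q ^ (m * j + 1)).re)

theorem circleGap_term_nonneg (q : ℂ) (k : ℕ) : 0 ≤ ‖q‖ ^ k - (q ^ k).re := by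
  rw [← norm_pow]; exact sub_nonneg.mpr (Complex.re_le_norm _)

theorem circleGap_nonneg (m : ℕ) (q : ℂ) : 0 ≤ circleGap m q :=
  tsum_nonneg fun _ => circleGap_term_nonneg q _

theorem summable_circleGap {m : ℕ} (hm : 0 < m) {q : ℂ} (hq : ‖q‖ < 1) :
    Summable fun j : ℕ => (‖q‖ ^ (m * j + 1) - (q ^ (m * j + 1)).re) := by
  have h1 : Summable fun k : ℕ => ‖q‖ ^ k := summable_geometric_of_lt_one (norm_nonneg _) hq
  have h2 : Summable fun k : ℕ => (q ^ k).re :=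
    (Complex.hasSum_re (summable_geometric_of_norm_lt_one hq).hasSum).summable
  exact (h1.sub h2).comp_injective (mul_add_one_injective hm)

theorem summable_log_norm_one_sub_pow {q : ℂ} (hq : ‖q‖ < 1) :
    Summable fun k : ℕ => Real.log ‖1 - q ^ (k + 1)‖ := by
  have := Summable.summable_log_norm_one_add (f := fun k : ℕ => -q ^ (k + 1))
    (by simpa using summable_norm_pow_succ hq)
  simpa only [← sub_eq_add_neg] using this

theorem norm_eulerProd {q : ℂ} (hq : ‖q‖ < 1) :
    ‖eulerProd q‖ = Real.exp (∑' k : ℕ, Real.log ‖1 - q ^ (k + 1)‖) := by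
  rw [eulerProd, (ModularForm.multipliable_one_sub_pow hq).norm_tprod]
  exact (Real.rexp_tsum_eq_tprod
    (fun k => norm_pos_iff.mpr (one_sub_pow_ne_zero hq k.succ_ne_zero))
    (summable_log_norm_one_sub_pow hq)).symm

theorem norm_one_sub_norm_pow {q : ℂ} (hq : ‖q‖ < 1) (k : ℕ) :
    ‖1 - (‖q‖ : ℂ) ^ k‖ = 1 - ‖q ^ k‖ := by
  have : (1 - (‖q‖ : ℂ) ^ k) = ((1 - ‖q‖ ^ k : ℝ) : ℂ) := by push_cast; rfl
  rw [this, Complex.norm_real, norm_pow, Real.norm_of_nonneg]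
  exact sub_nonneg.mpr (pow_le_one₀ (norm_nonneg _) hq.le)

/-- In `E(q ^ m) / E(q)` only the factors `1 / (1 - q ^ k)` with `m ∤ k` survive; keeping the loss
of those with `k ≡ 1 mod m` bounds the quotient on a circle by its value on the positive axis. -/
theorem norm_eulerProd_div_le {m : ℕ} (hm : 2 ≤ m) {q : ℂ} (hq : ‖q‖ < 1) :
    ‖eulerProd (q ^ m) / eulerProd q‖ ≤
      ‖eulerProd ((‖q‖ : ℂ) ^ m) / eulerProd ‖q‖‖ * Real.exp (-(circleGap m q / 4)) := by
  have hm0 : m ≠ 0 := by omega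
  have hmp : 0 < m := by omega
  have hr : ‖(‖q‖ : ℂ)‖ < 1 := by simpa using hq
  have hqm : ‖q ^ m‖ < 1 := by rw [norm_pow]; exact pow_lt_one₀ (norm_nonneg _) hq hm0
  have hrm : ‖(‖q‖ : ℂ) ^ m‖ < 1 := by rw [norm_pow]; exact pow_lt_one₀ (norm_nonneg _) hr hm0
  set g : ℕ → ℝ := fun k => Real.log ‖1 - q ^ (k + 1)‖ - Real.log ‖1 - (‖q‖ : ℂ) ^ (k + 1)‖ with hg
  have hgs : Summable g := (summable_log_norm_one_sub_pow hq).sub (summable_log_norm_one_sub_pow hr)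
  have hgap : ∀ k, (‖q‖ ^ (k + 1) - (q ^ (k + 1)).re) / 4 ≤ g k := fun k => by
    have h1 : ‖q ^ (k + 1)‖ < 1 := by
      rw [norm_pow]; exact pow_lt_one₀ (norm_nonneg _) hq k.succ_ne_zero
    have := le_log_norm_one_sub h1
    rw [hg]
    simp only
    rw [norm_one_sub_norm_pow hq, ← norm_pow]
    exact this
  have hg0 : ∀ k, 0 ≤ g k := fun k =>
    (div_nonneg (circleGap_term_nonneg q _) (by norm_num)).trans (hgap k)
  set a : ℕ → ℕ := fun k => m * k + (m - 1) with ha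
  set b : ℕ → ℕ := fun j => m * j with hb
  have hai : Function.Injective a := fun x y h => by
    exact Nat.eq_of_mul_eq_mul_left hmp (by simpa [ha] using h)
  have hbi : Function.Injective b := fun x y h => Nat.eq_of_mul_eq_mul_left hmp h
  have hdisj : Disjoint (Set.range a) (Set.range b) := by
    rw [Set.disjoint_left]
    rintro _ ⟨x, rfl⟩ ⟨y, hy⟩
    have h1 : (m * y) % m = (m * x + (m - 1)) % m := congrArg (· % m) hy
    rw [Nat.mul_mod_right, Nat.mul_add_mod, Nat.mod_eq_of_lt (by omega)] at h1
    omega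
  have hsplit : ∑' k, g (a k) + ∑' j, g (b j) ≤ ∑' k, g k := by
    rw [← tsum_range g hai, ← tsum_range g hbi,
      ← Summable.tsum_union_disjoint hdisj (hgs.subtype _) (hgs.subtype _)]
    exact Summable.tsum_subtype_le g _ hg0 hgs
  have hga : ∑' k, g (a k) = ∑' k : ℕ, Real.log ‖1 - (q ^ m) ^ (k + 1)‖ -
      ∑' k : ℕ, Real.log ‖1 - ((‖q‖ : ℂ) ^ m) ^ (k + 1)‖ := by
    rw [← (summable_log_norm_one_sub_pow hqm).tsum_sub (summable_log_norm_one_sub_pow hrm)]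
    refine tsum_congr fun k => ?_
    have : a k + 1 = m * (k + 1) := by simp only [ha]; rw [mul_add]; omega
    simp only [hg]
    rw [this, pow_mul, pow_mul]
  have hgb : circleGap m q / 4 ≤ ∑' j, g (b j) := by
    rw [circleGap, ← tsum_div_const]
    exact ((summable_circleGap (by omega) hq).div_const 4).tsum_le_tsum (fun j => hgap (b j))
      (hgs.comp_injective hbi)
  have hgt : ∑' k, g k = ∑' k : ℕ, Real.log ‖1 - q ^ (k + 1)‖ -
      ∑' k : ℕ, Real.log ‖1 - (‖q‖ : ℂ) ^ (k + 1)‖ :=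
    (summable_log_norm_one_sub_pow hq).tsum_sub (summable_log_norm_one_sub_pow hr)
  rw [norm_div, norm_div, norm_eulerProd hq, norm_eulerProd hr, norm_eulerProd hqm,
    norm_eulerProd hrm, ← Real.exp_sub, ← Real.exp_sub, ← Real.exp_add, Real.exp_le_exp]
  linarith

theorem norm_oddProd {x : ℂ} (hx : ‖x‖ < 1) :
    ‖oddProd x‖ = Real.exp (∑' j : ℕ, Real.log ‖1 + x ^ (2 * j + 1)‖) := by
  rw [oddProd, (multipliable_one_add_pow_odd hx).norm_tprod]
  refine (Real.rexp_tsum_eq_tprod (fun j => norm_pos_iff.mpr fun h => ?_)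
    (summable_norm_pow_odd hx).summable_log_norm_one_add).symm
  have h1 : ‖x ^ (2 * j + 1)‖ < 1 := by
    rw [norm_pow]; exact pow_lt_one₀ (norm_nonneg _) hx (by omega)
  rw [← norm_neg, ← eq_neg_of_add_eq_zero_left h, norm_one] at h1
  exact lt_irrefl _ h1

theorem norm_oddProd_le {x : ℂ} (hx : ‖x‖ < 1) :
    ‖oddProd x‖ ≤ ‖oddProd ‖x‖‖ * Real.exp (-(circleGap 2 x / 4)) := by
  have hr : ‖(‖x‖ : ℂ)‖ < 1 := by simpa using hx
  have h1 := (summable_norm_pow_odd hx).summable_log_norm_one_add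
  have h2 := (summable_norm_pow_odd hr).summable_log_norm_one_add
  have h3 : circleGap 2 x / 4 ≤ ∑' j : ℕ, Real.log ‖1 + (‖x‖ : ℂ) ^ (2 * j + 1)‖ -
      ∑' j : ℕ, Real.log ‖1 + x ^ (2 * j + 1)‖ := by
    rw [← h2.tsum_sub h1, circleGap, ← tsum_div_const]
    refine ((summable_circleGap two_pos hx).div_const 4).tsum_le_tsum (fun j => ?_) (h2.sub h1)
    have h4 : ‖x ^ (2 * j + 1)‖ < 1 := by
      rw [norm_pow]; exact pow_lt_one₀ (norm_nonneg _) hx (by omega)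
    have h5 := le_neg_log_norm_one_add h4
    have h6 : ‖1 + (‖x‖ : ℂ) ^ (2 * j + 1)‖ = 1 + ‖x ^ (2 * j + 1)‖ := by
      have : (1 + (‖x‖ : ℂ) ^ (2 * j + 1)) = ((1 + ‖x‖ ^ (2 * j + 1) : ℝ) : ℂ) := by push_cast; rfl
      rw [this, Complex.norm_real, norm_pow, Real.norm_of_nonneg (by positivity)]
    rw [h6, ← norm_pow]
    exact h5
  rw [norm_oddProd hx, norm_oddProd hr, ← Real.exp_add, Real.exp_le_exp]
  linarith

theorem norm_one_sub_sq_of_norm_eq_one {u : ℂ} (hu : ‖u‖ = 1) : ‖1 - u‖ ^ 2 = 2 * (1 - u.re) := by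
  rw [norm_one_sub_sq, hu]; ring

theorem norm_one_sub_pow_le {u : ℂ} (hu : ‖u‖ = 1) (k : ℕ) : ‖1 - u ^ k‖ ≤ k * ‖1 - u‖ := by
  induction k with
  | zero => simp
  | succ k ih =>
    have : 1 - u ^ (k + 1) = (1 - u ^ k) + u ^ k * (1 - u) := by ring
    rw [this]
    refine (norm_add_le _ _).trans ?_
    rw [norm_mul, norm_pow, hu, one_pow, one_mul]
    push_cast
    linarith

/-- Near `u = 1` the map `u ↦ u ^ m` does not bring points much closer to `1`. -/
theorem le_norm_one_sub_pow {m : ℕ} (hm : 0 < m) {u : ℂ} (hu : ‖u‖ = 1)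
    (h : ‖1 - u‖ ≤ 1 / (m : ℝ) ^ 2) : ‖1 - u‖ / 2 ≤ ‖1 - u ^ m‖ := by
  have hm' : (1 : ℝ) ≤ m := by exact_mod_cast hm
  have h1 : ‖(m : ℂ) - ∑ k ∈ Finset.range m, u ^ k‖ ≤ m - 1 / 2 := by
    have : (m : ℂ) - ∑ k ∈ Finset.range m, u ^ k = ∑ k ∈ Finset.range m, (1 - u ^ k) := by
      rw [Finset.sum_sub_distrib]; simp
    rw [this]
    calc ‖∑ k ∈ Finset.range m, (1 - u ^ k)‖ ≤
        ∑ k ∈ Finset.range m, (m - 1) * (1 / (m : ℝ) ^ 2) := by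
          refine norm_sum_le_of_le _ fun k hk => (norm_one_sub_pow_le hu k).trans ?_
          have : (k : ℝ) + 1 ≤ m := by exact_mod_cast Finset.mem_range.mp hk
          gcongr
          linarith
      _ = 1 - 1 / m := by
          rw [Finset.sum_const, Finset.card_range, nsmul_eq_mul]; field_simp
      _ ≤ m - 1 / 2 := by
          have : 0 < 1 / (m : ℝ) := by positivity
          rcases eq_or_lt_of_le (Nat.succ_le_of_lt hm) with h2 | h2
          · rw [← h2]; norm_num
          · have : (2 : ℝ) ≤ m := by exact_mod_cast h2
            linarith
  have h2 : (1 : ℝ) / 2 ≤ ‖∑ k ∈ Finset.range m, u ^ k‖ := by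
    have := norm_sub_norm_le (m : ℂ) (∑ k ∈ Finset.range m, u ^ k)
    rw [Complex.norm_natCast] at this
    linarith
  rw [← mul_neg_geom_sum, norm_mul]
  nlinarith [norm_nonneg (1 - u)]

theorem norm_exp_neg_mul {t : ℝ} {u : ℂ} (hu : ‖u‖ = 1) :
    ‖(Real.exp (-t) : ℂ) * u‖ = Real.exp (-t) := by
  rw [norm_mul, hu, mul_one, Complex.norm_real, Real.norm_of_nonneg (Real.exp_pos _).le]

/-- The gap is at least `r (1 / (1 - r ^ m) - 1 / |1 - q ^ m|)`, by summing the geometric series,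
and `|1 - q ^ m| ^ 2 = (1 - r ^ m) ^ 2 + r ^ m |1 - u ^ m| ^ 2`. -/
theorem circleGap_ge_of_pow {m : ℕ} (hm : 0 < m) {t : ℝ} (ht : 0 < t) (ht1 : t ≤ 1) {u : ℂ}
    (hu : ‖u‖ = 1) (h : ‖1 - u‖ / 2 ≤ ‖1 - u ^ m‖) :
    Real.exp (-(m + 1)) / (24 * m ^ 3) / t * min 1 ((‖1 - u‖ / t) ^ 2) ≤
      circleGap m (Real.exp (-t) * u) := by
  have hm' : (1 : ℝ) ≤ m := by exact_mod_cast hm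
  set r := Real.exp (-t) with hr
  have hr0 : 0 < r := Real.exp_pos _
  have hr1 : r < 1 := Real.exp_lt_one_iff.mpr (by linarith)
  set q : ℂ := r * u with hq
  have hqn : ‖q‖ = r := norm_exp_neg_mul hu
  have hqm : ‖q ^ m‖ = r ^ m := by rw [norm_pow, hqn]
  have hrm1 : r ^ m < 1 := pow_lt_one₀ hr0.le hr1 hm.ne'
  have hs1 : HasSum (fun j : ℕ => r ^ (m * j + 1)) (r * (1 - r ^ m)⁻¹) := by
    refine ((hasSum_geometric_of_lt_one (by positivity) hrm1).mul_left r).congr_fun fun j => ?_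
    rw [pow_succ, pow_mul, mul_comm]
  have hs2 : HasSum (fun j : ℕ => q ^ (m * j + 1)) (q * (1 - q ^ m)⁻¹) := by
    refine ((hasSum_geometric_of_norm_lt_one (hqm ▸ hrm1)).mul_left q).congr_fun fun j => ?_
    rw [pow_succ, pow_mul, mul_comm]
  have hgap : circleGap m q = r * (1 - r ^ m)⁻¹ - (q * (1 - q ^ m)⁻¹).re := by
    rw [circleGap, hqn]
    exact (hs1.sub (Complex.hasSum_re hs2)).tsum_eq
  set y := 1 - r ^ m with hy
  set Y := ‖1 - q ^ m‖ with hY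
  have hy0 : 0 < y := sub_pos.mpr hrm1
  have hrm : Real.exp (-m) ≤ r ^ m := by
    rw [hr, ← Real.exp_nat_mul, Real.exp_le_exp]; nlinarith
  have hymt : y ≤ m * t := by
    have := Real.add_one_le_exp (m * -t)
    rw [Real.exp_nat_mul, ← hr] at this
    linarith
  have hY2 : Y ^ 2 = y ^ 2 + r ^ m * ‖1 - u ^ m‖ ^ 2 := by
    have hum : ‖u ^ m‖ = 1 := by rw [norm_pow, hu, one_pow]
    rw [hY, norm_one_sub_sq, hqm, norm_one_sub_sq_of_norm_eq_one hum, hq, mul_pow,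
      ← Complex.ofReal_pow, Complex.re_ofReal_mul]
    ring
  set x := min 1 ((‖1 - u‖ / t) ^ 2) with hx
  have hx0 : 0 ≤ x := le_min one_pos.le (sq_nonneg _)
  have hx1 : x ≤ 1 := min_le_left _ _
  set c := Real.exp (-m) / (12 * m ^ 2) with hc
  have hc0 : 0 < c := by positivity
  have hc1 : c ≤ 1 := by
    rw [hc, div_le_one (by positivity)]
    have : Real.exp (-m) ≤ 1 := Real.exp_le_one_iff.mpr (by linarith)
    nlinarith
  have hcx : c * x ≤ 1 := mul_le_one₀ hc1 hx0 hx1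
  have hcx0 : 0 ≤ c * x := by positivity
  have hYy : y * (1 + c * x) ≤ Y := by
    refine le_of_sq_le_sq ?_ (norm_nonneg _)
    have h1 : x * y ^ 2 ≤ ‖1 - u‖ ^ 2 * m ^ 2 := by
      calc x * y ^ 2 ≤ (‖1 - u‖ / t) ^ 2 * (m * t) ^ 2 := by gcongr; exact min_le_right _ _
        _ = _ := by field_simp
    have h2 : 3 * c * (‖1 - u‖ ^ 2 * m ^ 2) = Real.exp (-m) * (‖1 - u‖ / 2) ^ 2 := by
      rw [hc]; field_simp; ring
    calc (y * (1 + c * x)) ^ 2 = y ^ 2 * (1 + 2 * (c * x) + (c * x) * (c * x)) := by ring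
      _ ≤ y ^ 2 * (1 + 2 * (c * x) + (c * x) * 1) := by gcongr
      _ = y ^ 2 + 3 * c * (x * y ^ 2) := by ring
      _ ≤ y ^ 2 + 3 * c * (‖1 - u‖ ^ 2 * m ^ 2) := by gcongr
      _ = y ^ 2 + Real.exp (-m) * (‖1 - u‖ / 2) ^ 2 := by rw [h2]
      _ ≤ y ^ 2 + r ^ m * ‖1 - u ^ m‖ ^ 2 := by gcongr
      _ = Y ^ 2 := hY2.symm
  have hre : (q * (1 - q ^ m)⁻¹).re ≤ r * (y * (1 + c * x))⁻¹ := by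
    refine (Complex.re_le_norm _).trans ?_
    rw [norm_mul, norm_inv, hqn]
    gcongr
  have hone : Real.exp (-1) ≤ r := by rw [hr, Real.exp_le_exp]; linarith
  have hfinal : c * x / 2 / (m * t) ≤ y⁻¹ - (y * (1 + c * x))⁻¹ := by
    have : y⁻¹ - (y * (1 + c * x))⁻¹ = c * x / (1 + c * x) / y := by field_simp; ring
    rw [this]
    gcongr
    linarith
  rw [hgap]
  calc Real.exp (-(m + 1)) / (24 * m ^ 3) / t * x = Real.exp (-1) * (c * x / 2 / (m * t)) := by
        rw [show (-((m : ℝ) + 1)) = -1 + -m by ring, Real.exp_add, hc]; field_simp; ring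
    _ ≤ r * (y⁻¹ - (y * (1 + c * x))⁻¹) := by
        gcongr
    _ ≤ _ := by rw [mul_sub]; linarith

/-- If `u` is far from `1`, then `u ^ k` and `u ^ (2 k - 1)` cannot both be near `1`, since
`u = (u ^ k) ^ 2 / u ^ (2 k - 1)`; and `2 k - 1 ≡ 1` if `k ≡ 1` modulo `m`. -/
theorem circleGap_ge_of_far {m : ℕ} (hm : 0 < m) {t : ℝ} (ht : 0 < t) (ht1 : t ≤ 1) {u : ℂ}
    (hu : ‖u‖ = 1) (h : 1 / (m : ℝ) ^ 2 ≤ ‖1 - u‖) :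
    Real.exp (-2) / (40 * m ^ 5) / t ≤ circleGap m (Real.exp (-t) * u) := by
  have hm' : (1 : ℝ) ≤ m := by exact_mod_cast hm
  set r := Real.exp (-t) with hr
  have hr0 : 0 < r := Real.exp_pos _
  have hr1 : r < 1 := Real.exp_lt_one_iff.mpr (by linarith)
  set q : ℂ := r * u with hq
  have hqn : ‖q‖ = r := norm_exp_neg_mul hu
  have hterm : ∀ k : ℕ, ‖q‖ ^ k - (q ^ k).re = r ^ k * (‖1 - u ^ k‖ ^ 2 / 2) := fun k => by
    have huk : ‖u ^ k‖ = 1 := by rw [norm_pow, hu, one_pow]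
    rw [norm_one_sub_sq_of_norm_eq_one huk, hqn, hq, mul_pow, ← Complex.ofReal_pow,
      Complex.re_ofReal_mul]
    ring
  have hsum := summable_circleGap hm (q := q) (by rw [hqn]; exact hr1)
  set f : ℕ → ℝ := fun j => ‖q‖ ^ (m * j + 1) - (q ^ (m * j + 1)).re with hf
  have hf0 : ∀ j, 0 ≤ f j := fun j => circleGap_term_nonneg q _
  have hinj : Function.Injective fun j : ℕ => 2 * j := fun a b h => by simpa using h
  have hpt : ∀ j : ℕ, r ^ (2 * (m * j + 1)) * (‖1 - u‖ ^ 2 / 2) ≤ 8 * f j + 2 * f (2 * j) := by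
    intro j
    simp only [hf, hterm]
    set k := m * j + 1 with hk
    have hk2 : m * (2 * j) + 1 + 1 = 2 * k := by rw [hk]; ring
    have htri : ‖1 - u‖ ≤ 2 * ‖1 - u ^ k‖ + ‖1 - u ^ (m * (2 * j) + 1)‖ := by
      have e : u ^ (m * (2 * j) + 1) * (1 - u) =
          (1 - u ^ k) * (1 + u ^ k) - (1 - u ^ (m * (2 * j) + 1)) := by
        linear_combination -(congrArg (u ^ ·) hk2)
      have h1 : ‖u ^ (m * (2 * j) + 1) * (1 - u)‖ = ‖1 - u‖ := by
        rw [norm_mul, norm_pow, hu, one_pow, one_mul]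
      rw [← h1, e]
      refine (norm_sub_le _ _).trans ?_
      have h2 : ‖1 + u ^ k‖ ≤ 2 := by
        refine (norm_add_le _ _).trans ?_
        rw [norm_pow, hu]; norm_num
      rw [norm_mul]
      nlinarith [norm_nonneg (1 - u ^ k)]
    set a := ‖1 - u ^ k‖
    set b := ‖1 - u ^ (m * (2 * j) + 1)‖
    have hsq : ‖1 - u‖ ^ 2 ≤ 8 * a ^ 2 + 2 * b ^ 2 := by
      calc ‖1 - u‖ ^ 2 ≤ (2 * a + b) ^ 2 := by gcongr
        _ ≤ _ := by nlinarith [sq_nonneg (2 * a - b)]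
    have hr2 : r ^ (2 * k) ≤ r ^ k := pow_le_pow_of_le_one hr0.le hr1.le (by omega)
    have hr3 : r ^ (2 * k) ≤ r ^ (m * (2 * j) + 1) :=
      pow_le_pow_of_le_one hr0.le hr1.le (by omega)
    calc r ^ (2 * k) * (‖1 - u‖ ^ 2 / 2) ≤ r ^ (2 * k) * ((8 * a ^ 2 + 2 * b ^ 2) / 2) := by gcongr
      _ = 8 * (r ^ (2 * k) * (a ^ 2 / 2)) + 2 * (r ^ (2 * k) * (b ^ 2 / 2)) := by ring
      _ ≤ _ := by gcongr
  have hrm1 : r ^ (2 * m) < 1 := pow_lt_one₀ hr0.le hr1 (by omega)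
  have hs1 : HasSum (fun j : ℕ => r ^ (2 * (m * j + 1)) * (‖1 - u‖ ^ 2 / 2))
      (r ^ 2 * (1 - r ^ (2 * m))⁻¹ * (‖1 - u‖ ^ 2 / 2)) := by
    refine (((hasSum_geometric_of_lt_one (by positivity) hrm1).mul_left (r ^ 2)).congr_fun
      fun j => ?_).mul_right _
    rw [← pow_mul, ← pow_add]; congr 1; ring
  have hle : r ^ 2 * (1 - r ^ (2 * m))⁻¹ * (‖1 - u‖ ^ 2 / 2) ≤ 10 * circleGap m q := by
    have hs2 := (hsum.mul_left 8).add ((hsum.comp_injective hinj).mul_left 2)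
    have h1 : _ ≤ ∑' j, (8 * f j + 2 * (f ∘ fun j => 2 * j) j) :=
      hs1.tsum_eq ▸ hs1.summable.tsum_le_tsum hpt hs2
    rw [(hsum.mul_left 8).tsum_add ((hsum.comp_injective hinj).mul_left 2), tsum_mul_left,
      tsum_mul_left] at h1
    have h2 : ∑' j, (f ∘ fun j => 2 * j) j ≤ ∑' j, f j := tsum_comp_le_tsum_of_inj hsum hf0 hinj
    have h3 : circleGap m q = ∑' j, f j := rfl
    rw [h3]
    linarith
  have hymt : 1 - r ^ (2 * m) ≤ 2 * m * t := by
    have := Real.add_one_le_exp (((2 * m : ℕ) : ℝ) * -t)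
    rw [Real.exp_nat_mul, ← hr] at this
    push_cast at this
    linarith
  have hr2 : Real.exp (-2) ≤ r ^ 2 := by
    rw [hr, ← Real.exp_nat_mul, Real.exp_le_exp]; push_cast; linarith
  have hy0 : 0 < 1 - r ^ (2 * m) := sub_pos.mpr hrm1
  have hmain : Real.exp (-2) * (2 * m * t)⁻¹ * ((1 / (m : ℝ) ^ 2) ^ 2 / 2) ≤
      r ^ 2 * (1 - r ^ (2 * m))⁻¹ * (‖1 - u‖ ^ 2 / 2) := by gcongr
  have heq : Real.exp (-2) * (2 * m * t)⁻¹ * ((1 / (m : ℝ) ^ 2) ^ 2 / 2) =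
      10 * (Real.exp (-2) / (40 * m ^ 5) / t) := by field_simp; norm_num
  linarith

/-- For small `t` the gap at `e ^ (-t) u` has order at least `1 / t`, except for `u` within a
distance of order `t` from `1`, where it grows quadratically in `|1 - u| / t`. -/
theorem exists_circleGap_ge {m : ℕ} (hm : 0 < m) :
    ∃ κ : ℝ, 0 < κ ∧ ∀ t : ℝ, 0 < t → t ≤ 1 → ∀ u : ℂ, ‖u‖ = 1 →
      κ / t * min 1 ((‖1 - u‖ / t) ^ 2) ≤ circleGap m (Real.exp (-t) * u) := by
  have hm' : (0 : ℝ) < m := by exact_mod_cast hm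
  refine ⟨min (Real.exp (-(m + 1)) / (24 * m ^ 3)) (Real.exp (-2) / (40 * m ^ 5)),
    lt_min (by positivity) (by positivity), fun t ht ht1 u hu => ?_⟩
  have h0 : 0 ≤ min 1 ((‖1 - u‖ / t) ^ 2) := le_min one_pos.le (sq_nonneg _)
  rcases le_total ‖1 - u‖ (1 / (m : ℝ) ^ 2) with h | h
  · refine le_trans ?_ (circleGap_ge_of_pow hm ht ht1 hu (le_norm_one_sub_pow hm hu h))
    gcongr
    exact min_le_left _ _
  · refine le_trans ?_ (circleGap_ge_of_far hm ht ht1 hu h)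
    refine le_trans (mul_le_of_le_one_right (by positivity) (min_le_left _ _)) ?_
    gcongr
    exact min_le_right _ _

theorem sq_mul_min_one_le {a b e : ℝ} (ha : 0 ≤ a) (he : 0 ≤ e) (he1 : e ≤ 1) (h : e * a ≤ b) :
    e ^ 2 * min 1 (a ^ 2) ≤ min 1 (b ^ 2) := by
  refine le_min ?_ ?_
  · exact mul_le_one₀ (pow_le_one₀ he he1) (le_min one_pos.le (sq_nonneg _)) (min_le_left _ _)
  · calc e ^ 2 * min 1 (a ^ 2) ≤ e ^ 2 * a ^ 2 := by gcongr; exact min_le_right _ _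
      _ = (e * a) ^ 2 := by ring
      _ ≤ b ^ 2 := by gcongr

theorem abs_le_norm_one_sub_exp {θ : ℝ} (hθ : |θ| ≤ Real.pi) :
    2 / Real.pi * |θ| ≤ ‖1 - Complex.exp (θ * Complex.I)‖ := by
  rw [norm_sub_rev, mul_comm (θ : ℂ), Complex.norm_exp_I_mul_ofReal_sub_one, Real.norm_eq_abs,
    abs_mul, abs_two]
  have h1 : |θ / 2| = |θ| / 2 := by rw [abs_div, abs_two]
  have := Real.mul_abs_le_abs_sin (x := θ / 2) (by rw [h1]; linarith)
  rw [h1] at this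
  linarith

theorem exp_neg_sub_mul_I (t θ : ℝ) : Complex.exp (-(t - θ * Complex.I)) =
    (Real.exp (-t) : ℂ) * Complex.exp (θ * Complex.I) := by
  rw [Complex.ofReal_exp, ← Complex.exp_add]; congr 1; push_cast; ring

/-- Off the positive axis `(E(q ^ m) / E(q)) ^ h` is exponentially smaller than on it. -/
theorem exists_norm_regular_le {m h : ℕ} (hm : 2 ≤ m) (hh : 1 ≤ h) :
    ∃ κ : ℝ, 0 < κ ∧ ∀ t : ℝ, 0 < t → t ≤ 1 → ∀ u : ℂ, ‖u‖ = 1 →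
      ‖(eulerProd ((Real.exp (-t) * u) ^ m) / eulerProd (Real.exp (-t) * u)) ^ h‖ ≤
        ‖(eulerProd ((Real.exp (-t) : ℂ) ^ m) / eulerProd (Real.exp (-t) : ℂ)) ^ h‖ *
          Real.exp (-(κ / t * min 1 ((‖1 - u‖ / t) ^ 2))) := by
  obtain ⟨κ, hκ, hgap⟩ := exists_circleGap_ge (m := m) (by omega)
  refine ⟨κ / 4, by positivity, fun t ht ht1 u hu => ?_⟩
  have hqn := norm_exp_neg_mul (t := t) hu
  have h1 := norm_eulerProd_div_le hm (q := Real.exp (-t) * u)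
    (by rw [hqn]; exact Real.exp_lt_one_iff.mpr (by linarith))
  rw [hqn] at h1
  rw [norm_pow, norm_pow]
  refine (pow_le_pow_left₀ (norm_nonneg _) h1 h).trans ?_
  rw [mul_pow, ← Real.exp_nat_mul]
  have h2 := hgap t ht ht1 u hu
  have hh' : (1 : ℝ) ≤ h := by exact_mod_cast hh
  have h3 := circleGap_nonneg m (Real.exp (-t) * u)
  gcongr
  have : κ / 4 / t * min 1 ((‖1 - u‖ / t) ^ 2) = κ / t * min 1 ((‖1 - u‖ / t) ^ 2) / 4 := by ring
  rw [this]
  nlinarith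

/-- Off the positive axis `E(-q ^ M) / E(q ^ 2)`, with `M` odd, is exponentially smaller than on it:
it is `E(q ^ (2 M)) / E(q ^ 2)` times `∏_{k odd} (1 + q ^ (M k))`, and `q ^ 2` and `q ^ M` cannot
both be near the positive axis. -/
theorem exists_norm_odd_le (m : ℕ) :
    ∃ κ : ℝ, 0 < κ ∧ ∃ t₀ : ℝ, 0 < t₀ ∧ ∀ t : ℝ, 0 < t → t ≤ t₀ → ∀ u : ℂ, ‖u‖ = 1 →
      ‖eulerProd (-(Real.exp (-t) * u) ^ (2 * m + 1)) / eulerProd ((Real.exp (-t) * u) ^ 2)‖ ≤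
        ‖eulerProd (-(Real.exp (-t) : ℂ) ^ (2 * m + 1)) / eulerProd ((Real.exp (-t) : ℂ) ^ 2)‖ *
          Real.exp (-(κ / t * min 1 ((‖1 - u‖ / t) ^ 2))) := by
  set M := 2 * m + 1 with hM
  obtain ⟨κ₁, hκ₁, hgap₁⟩ := exists_circleGap_ge (m := 2) two_pos
  obtain ⟨κ₂, hκ₂, hgap₂⟩ := exists_circleGap_ge (m := M) (by omega)
  have hM1 : (1 : ℝ) ≤ M := by exact_mod_cast (by omega : 1 ≤ M)
  have hmM : (M : ℝ) = 2 * m + 1 := by rw [hM]; push_cast; ring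
  set e : ℝ := 1 / (4 * M) with he
  have he0 : 0 < e := by positivity
  have he1 : e ≤ 1 := by rw [he, div_le_one (by positivity)]; linarith
  set κ := min (κ₁ / M) (κ₂ / 2) with hκ
  have hκ0 : 0 < κ := lt_min (by positivity) (by positivity)
  refine ⟨κ * e ^ 2 / 4, by positivity, 1 / (2 * M), by positivity, fun t ht ht0 u hu => ?_⟩
  have htM : M * t ≤ 1 / 2 := by
    calc M * t ≤ M * (1 / (2 * M)) := by gcongr
      _ = 1 / 2 := by field_simp
  have ht2 : 2 * t ≤ 1 := by nlinarith
  set r := Real.exp (-t) with hr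
  have hr1 : r < 1 := Real.exp_lt_one_iff.mpr (by linarith)
  set q : ℂ := r * u with hq
  have hqn : ‖q‖ = r := norm_exp_neg_mul hu
  have hpowlt : ∀ {k : ℕ}, k ≠ 0 → r ^ k < 1 := fun hk => pow_lt_one₀ (Real.exp_pos _).le hr1 hk
  have hfac : ∀ {p : ℂ}, ‖p‖ = r → eulerProd (-p ^ M) / eulerProd (p ^ 2) =
      eulerProd ((p ^ 2) ^ M) / eulerProd (p ^ 2) * oddProd (p ^ M) := by
    intro p hp
    rw [eulerProd_neg (by rw [norm_pow, hp]; exact hpowlt (by omega)), ← pow_mul, ← pow_mul,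
      mul_comm M 2]
    ring
  have hrn : ‖(r : ℂ)‖ = r := by
    rw [Complex.norm_real, Real.norm_of_nonneg (Real.exp_pos _).le]
  have hqM : ‖q ^ M‖ = r ^ M := by rw [norm_pow, hqn]
  have hq2 : ‖q ^ 2‖ = r ^ 2 := by rw [norm_pow, hqn]
  have hodd := norm_oddProd_le (x := q ^ M) (by rw [hqM]; exact hpowlt (by omega))
  rw [hqM, Complex.ofReal_pow] at hodd
  have hMeq : q ^ M = Real.exp (-(M * t)) * u ^ M := by
    rw [hq, hr, mul_pow, ← Complex.ofReal_pow, ← Real.exp_nat_mul, mul_neg]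
  have h2eq : q ^ 2 = Real.exp (-(2 * t)) * u ^ 2 := by
    rw [hq, hr, mul_pow, ← Complex.ofReal_pow, ← Real.exp_nat_mul]
    congr 3; push_cast; ring
  have hMt : 0 < M * t := by positivity
  have hg1 := hgap₁ (M * t) hMt (by linarith) (u ^ M) (by rw [norm_pow, hu, one_pow])
  have hg2 := hgap₂ (2 * t) (by positivity) ht2 (u ^ 2) (by rw [norm_pow, hu, one_pow])
  rw [← hMeq] at hg1
  rw [← h2eq] at hg2
  set x := min 1 ((‖1 - u‖ / t) ^ 2) with hx
  have hx0 : 0 ≤ x := le_min one_pos.le (sq_nonneg _)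
  have htri : ‖1 - u‖ ≤ ‖1 - u ^ M‖ + m * ‖1 - u ^ 2‖ := by
    have e1 : 1 - u = (1 - u ^ M) - u * (1 - (u ^ 2) ^ m) := by
      rw [hM, ← pow_mul]; ring
    calc ‖1 - u‖ = ‖(1 - u ^ M) - u * (1 - (u ^ 2) ^ m)‖ := by rw [← e1]
      _ ≤ ‖1 - u ^ M‖ + ‖u * (1 - (u ^ 2) ^ m)‖ := norm_sub_le _ _
      _ ≤ _ := by
        rw [norm_mul, hu, one_mul]
        gcongr
        exact norm_one_sub_pow_le (by rw [norm_pow, hu, one_pow]) m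
  -- Either `u ^ M` or, for `m ≠ 0`, `u ^ 2` is as far from `1` as `u` is, up to a constant.
  have hcase : ∃ D₁ D₂ : ℝ, κ * e ^ 2 / t * x ≤ D₁ + D₂ ∧ D₁ ≤ circleGap 2 (q ^ M) ∧
      ‖eulerProd ((q ^ 2) ^ M) / eulerProd (q ^ 2)‖ ≤
        ‖eulerProd (((r : ℂ) ^ 2) ^ M) / eulerProd ((r : ℂ) ^ 2)‖ * Real.exp (-(D₂ / 4)) := by
    have hA : ‖1 - u‖ / 2 ≤ ‖1 - u ^ M‖ → κ * e ^ 2 / t * x ≤ circleGap 2 (q ^ M) := by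
      intro hfar
      have h1 : e * (‖1 - u‖ / t) ≤ ‖1 - u ^ M‖ / (M * t) := by
        rw [he, div_mul_div_comm, div_le_div_iff₀ (by positivity) hMt]
        linarith [mul_nonneg hMt.le (norm_nonneg (1 - u)), mul_le_mul_of_nonneg_left hfar hMt.le]
      have h2 := sq_mul_min_one_le (by positivity) he0.le he1 h1
      refine le_trans ?_ hg1
      calc κ * e ^ 2 / t * x = κ / t * (e ^ 2 * x) := by ring
        _ ≤ κ₁ / M / t * (e ^ 2 * x) := by gcongr; exact min_le_left _ _
        _ = κ₁ / (M * t) * (e ^ 2 * x) := by rw [div_div]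
        _ ≤ _ := by gcongr
    rcases Nat.eq_zero_or_pos m with hm | hm
    · refine ⟨circleGap 2 (q ^ M), 0, ?_, le_rfl, ?_⟩
      · rw [add_zero]
        refine hA ?_
        rw [hm, Nat.cast_zero, zero_mul, add_zero] at htri
        linarith [norm_nonneg (1 - u)]
      · have hM1 : M = 1 := by omega
        have hne : ∀ {p : ℂ}, ‖p‖ = r → eulerProd (p ^ 2) ≠ 0 := fun hp =>
          eulerProd_ne_zero (by rw [norm_pow, hp]; exact hpowlt two_ne_zero)
        simp [hM1, div_self (hne hqn), div_self (hne hrn)]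
    · refine ⟨circleGap 2 (q ^ M), circleGap M (q ^ 2), ?_, le_rfl, ?_⟩
      · by_cases hfar : ‖1 - u‖ / 2 ≤ ‖1 - u ^ M‖
        · exact (hA hfar).trans (le_add_of_nonneg_right (circleGap_nonneg _ _))
        · have hfar2 : ‖1 - u‖ ≤ 2 * (m * ‖1 - u ^ 2‖) := by linarith
          have h1 : e * (‖1 - u‖ / t) ≤ ‖1 - u ^ 2‖ / (2 * t) := by
            rw [he, div_mul_div_comm, div_le_div_iff₀ (by positivity) (by positivity), hmM]
            linarith [mul_le_mul_of_nonneg_left hfar2 ht.le,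
              mul_nonneg ht.le (norm_nonneg (1 - u ^ 2)),
              mul_nonneg (mul_nonneg ht.le (norm_nonneg (1 - u ^ 2))) (Nat.cast_nonneg (α := ℝ) m)]
          have h2 := sq_mul_min_one_le (by positivity) he0.le he1 h1
          refine le_trans (le_trans ?_ hg2) (le_add_of_nonneg_left (circleGap_nonneg _ _))
          calc κ * e ^ 2 / t * x = κ / t * (e ^ 2 * x) := by ring
            _ ≤ κ₂ / 2 / t * (e ^ 2 * x) := by gcongr; exact min_le_right _ _
            _ = κ₂ / (2 * t) * (e ^ 2 * x) := by rw [div_div]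
            _ ≤ _ := by gcongr
      · have := norm_eulerProd_div_le (m := M) (by omega) (q := q ^ 2)
          (by rw [hq2]; exact hpowlt two_ne_zero)
        rwa [hq2, Complex.ofReal_pow] at this
  obtain ⟨D₁, D₂, hD, hD1, hD2⟩ := hcase
  rw [hfac hqn, hfac hrn, norm_mul, norm_mul]
  calc _ ≤ (‖eulerProd (((r : ℂ) ^ 2) ^ M) / eulerProd ((r : ℂ) ^ 2)‖ * Real.exp (-(D₂ / 4))) *
          (‖oddProd ((r : ℂ) ^ M)‖ * Real.exp (-(D₁ / 4))) := by
        gcongr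
        refine hodd.trans ?_
        gcongr
    _ = ‖eulerProd (((r : ℂ) ^ 2) ^ M) / eulerProd ((r : ℂ) ^ 2)‖ * ‖oddProd ((r : ℂ) ^ M)‖ *
          Real.exp (-((D₁ + D₂) / 4)) := by
        rw [show -((D₁ + D₂) / 4) = -(D₂ / 4) + -(D₁ / 4) by ring, Real.exp_add]; ring
    _ ≤ _ := by
        gcongr
        calc κ * e ^ 2 / 4 / t * x = κ * e ^ 2 / t * x / 4 := by ring
          _ ≤ _ := by gcongr

/-! ### Cauchy's formula for the coefficients of the formal product -/

/-- The formal power series `p` converges absolutely to `f` in the open unit disc. -/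
def ConvergesTo (p : ℝ⟦X⟧) (f : ℂ → ℂ) : Prop :=
  ∀ q : ℂ, ‖q‖ < 1 → Summable (fun n : ℕ => ‖((coeff n p : ℝ) : ℂ) * q ^ n‖) ∧
    HasSum (fun n : ℕ => ((coeff n p : ℝ) : ℂ) * q ^ n) (f q)

theorem convergesTo_one : ConvergesTo 1 1 := by
  intro q _
  have h0 : ∀ n : ℕ, n ≠ 0 → ((coeff n (1 : ℝ⟦X⟧) : ℝ) : ℂ) * q ^ n = 0 := fun n hn => by
    simp [coeff_one, hn]
  refine ⟨summable_of_ne_finset_zero (s := {0}) fun n hn => ?_, ?_⟩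
  · rw [h0 n (by simpa using hn), norm_zero]
  · simpa using hasSum_single (f := fun n : ℕ => ((coeff n (1 : ℝ⟦X⟧) : ℝ) : ℂ) * q ^ n) 0 h0

theorem ConvergesTo.mul {p₁ p₂ : ℝ⟦X⟧} {f₁ f₂ : ℂ → ℂ} (h₁ : ConvergesTo p₁ f₁)
    (h₂ : ConvergesTo p₂ f₂) : ConvergesTo (p₁ * p₂) (f₁ * f₂) := by
  intro q hq
  obtain ⟨s₁, e₁⟩ := h₁ q hq
  obtain ⟨s₂, e₂⟩ := h₂ q hq
  have hterm : ∀ n : ℕ, ((coeff n (p₁ * p₂) : ℝ) : ℂ) * q ^ n =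
      ∑ kl ∈ Finset.HasAntidiagonal.antidiagonal n,
        (((coeff kl.1 p₁ : ℝ) : ℂ) * q ^ kl.1) * (((coeff kl.2 p₂ : ℝ) : ℂ) * q ^ kl.2) := by
    intro n
    rw [coeff_mul]
    push_cast
    rw [Finset.sum_mul]
    refine Finset.sum_congr rfl fun kl hkl => ?_
    rw [← Finset.HasAntidiagonal.mem_antidiagonal.mp hkl, pow_add]
    ring
  have hs := summable_norm_sum_mul_antidiagonal_of_summable_norm s₁ s₂
  simp only [← hterm] at hs
  refine ⟨hs, ?_⟩
  have ht := tsum_mul_tsum_eq_tsum_sum_antidiagonal_of_summable_norm s₁ s₂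
  simp only [← hterm] at ht
  rw [e₁.tsum_eq, e₂.tsum_eq] at ht
  rw [Pi.mul_apply, ht]
  exact hs.of_norm.hasSum

theorem ConvergesTo.pow {p : ℝ⟦X⟧} {f : ℂ → ℂ} (hp : ConvergesTo p f) (h : ℕ) :
    ConvergesTo (p ^ h) (f ^ h) := by
  induction h with
  | zero => simpa using convergesTo_one
  | succ h ih => rw [pow_succ, pow_succ]; exact ih.mul hp

theorem convergesTo_one_sub_X_pow (a : ℕ) : ConvergesTo (1 - X ^ a) fun q => 1 - q ^ a := by
  intro q hq
  have h1 := (convergesTo_one q hq)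
  have h0 : ∀ n : ℕ, n ≠ a → ((coeff n (X ^ a : ℝ⟦X⟧) : ℝ) : ℂ) * q ^ n = 0 := fun n hn => by
    simp [coeff_X_pow, hn]
  have h2 : HasSum (fun n : ℕ => ((coeff n (X ^ a : ℝ⟦X⟧) : ℝ) : ℂ) * q ^ n) (q ^ a) := by
    simpa [coeff_X_pow] using
      hasSum_single (f := fun n : ℕ => ((coeff n (X ^ a : ℝ⟦X⟧) : ℝ) : ℂ) * q ^ n) a h0
  have hterm : ∀ n : ℕ, ((coeff n (1 - X ^ a : ℝ⟦X⟧) : ℝ) : ℂ) * q ^ n =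
      ((coeff n (1 : ℝ⟦X⟧) : ℝ) : ℂ) * q ^ n - ((coeff n (X ^ a : ℝ⟦X⟧) : ℝ) : ℂ) * q ^ n := by
    intro n
    rw [map_sub]; push_cast; ring
  simp only [hterm]
  exact ⟨(h1.2.summable.sub h2.summable).norm, h1.2.sub h2⟩

theorem one_sub_X_pow_inv {b : ℕ} (hb : 0 < b) :
    (1 - X ^ b : ℝ⟦X⟧)⁻¹ = PowerSeries.mk fun n => if b ∣ n then 1 else 0 := by
  have h0 : constantCoeff (1 - X ^ b : ℝ⟦X⟧) ≠ 0 := by simp [hb.ne']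
  rw [PowerSeries.inv_eq_iff_mul_eq_one h0]
  ext n
  rw [mul_sub, mul_one, map_sub, coeff_mul_X_pow', coeff_mk, coeff_one]
  by_cases hn : n = 0
  · simp [hn, hb.ne']
  · rw [if_neg hn]
    by_cases hbn : b ≤ n
    · rw [if_pos hbn, coeff_mk]
      simp only [Nat.dvd_sub_iff_left hbn dvd_rfl, sub_self]
    · have : ¬ b ∣ n := fun h => hbn (Nat.le_of_dvd (Nat.pos_of_ne_zero hn) h)
      simp [hbn, this]

theorem convergesTo_one_sub_X_pow_inv {b : ℕ} (hb : 0 < b) :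
    ConvergesTo (1 - X ^ b)⁻¹ fun q => (1 - q ^ b)⁻¹ := by
  intro q hq
  have hqb : ‖q ^ b‖ < 1 := by rw [norm_pow]; exact pow_lt_one₀ (norm_nonneg _) hq hb.ne'
  have hinj : Function.Injective fun k : ℕ => b * k := fun x y h => Nat.eq_of_mul_eq_mul_left hb h
  have hs : HasSum (fun n : ℕ => ((coeff n (1 - X ^ b : ℝ⟦X⟧)⁻¹ : ℝ) : ℂ) * q ^ n)
      (1 - q ^ b)⁻¹ := by
    rw [one_sub_X_pow_inv hb, ← hinj.hasSum_iff]
    · refine (hasSum_geometric_of_norm_lt_one hqb).congr_fun fun k => ?_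
      simp [pow_mul]
    · intro n hn
      have : ¬ b ∣ n := fun ⟨k, hk⟩ => hn ⟨k, hk.symm⟩
      simp [this]
  exact ⟨hs.summable.norm, hs⟩

/-- The partial products of `qProduct`. -/
theorem convergesTo_partialProd (s : ℕ) {t : ℕ} (ht : 1 ≤ t) (h K : ℕ) :
    ConvergesTo (∏ k ∈ Finset.range K, qRatio (s * (k + 1)) (t * (k + 1)) ^ h)
      fun q => ∏ k ∈ Finset.range K, ((1 - q ^ (s * (k + 1))) / (1 - q ^ (t * (k + 1)))) ^ h := by
  induction K with
  | zero => simpa using! convergesTo_one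
  | succ K ih =>
    simp only [Finset.prod_range_succ]
    exact ih.mul (((convergesTo_one_sub_X_pow _).mul
      (convergesTo_one_sub_X_pow_inv (Nat.mul_pos ht K.succ_pos))).pow h)

theorem integral_exp_int_mul_I (k : ℤ) :
    ∫ θ in (-Real.pi)..Real.pi, Complex.exp (k * Complex.I * θ) =
      if k = 0 then (2 * Real.pi : ℂ) else 0 := by
  split_ifs with hk
  · simp [hk]; ring
  · have hc : (k : ℂ) * Complex.I ≠ 0 := mul_ne_zero (by exact_mod_cast hk) Complex.I_ne_zero
    rw [integral_exp_mul_complex hc, div_eq_zero_iff]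
    left
    rw [sub_eq_zero, Complex.exp_eq_exp_iff_exists_int]
    exact ⟨k, by push_cast; ring⟩

/-- Cauchy's formula on the circle of radius `e ^ (-t)`, with a sign change `q ↦ σ q`. -/
theorem ConvergesTo.two_pi_mul_coeff {p : ℝ⟦X⟧} {f : ℂ → ℂ} (hp : ConvergesTo p f) {σ : ℝ}
    (hσ : |σ| = 1) {t : ℝ} (ht : 0 < t) (n : ℕ) :
    (2 * Real.pi * (σ ^ n * coeff n p : ℝ) : ℂ) = ∫ θ in (-Real.pi)..Real.pi,
      f (σ * Complex.exp (-(t - θ * Complex.I))) * Complex.exp (n * (t - θ * Complex.I)) := by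
  have hnorm : ∀ θ : ℝ, ‖(σ : ℂ) * Complex.exp (-(t - θ * Complex.I))‖ = Real.exp (-t) := by
    intro θ
    rw [norm_mul, Complex.norm_real, Real.norm_eq_abs, hσ, one_mul, Complex.norm_exp]
    simp
  have hlt : Real.exp (-t) < 1 := Real.exp_lt_one_iff.mpr (by linarith)
  have hnorm2 : ∀ θ : ℝ, ‖Complex.exp (n * (t - θ * Complex.I))‖ = Real.exp (n * t) := fun θ => by
    rw [Complex.norm_exp]
    simp
  have hsum : Summable fun j : ℕ => |coeff j p| * Real.exp (-t) ^ j := by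
    have := (hp (Real.exp (-t)) (by
      rw [Complex.norm_real, Real.norm_of_nonneg (Real.exp_pos _).le]; exact hlt)).1
    refine this.congr fun j => ?_
    rw [norm_mul, norm_pow, Complex.norm_real, Complex.norm_real, Real.norm_eq_abs,
      Real.norm_of_nonneg (Real.exp_pos _).le]
  have key := intervalIntegral.hasSum_integral_of_dominated_convergence
    (μ := MeasureTheory.volume) (a := -Real.pi) (b := Real.pi)
    (F := fun (j : ℕ) (θ : ℝ) => ((coeff j p : ℝ) : ℂ) *
      (σ * Complex.exp (-(t - θ * Complex.I))) ^ j * Complex.exp (n * (t - θ * Complex.I)))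
    (f := fun θ : ℝ => f (σ * Complex.exp (-(t - θ * Complex.I))) *
      Complex.exp (n * (t - θ * Complex.I)))
    (fun j _ => |coeff j p| * Real.exp (-t) ^ j * Real.exp (n * t))
    (fun j => Continuous.aestronglyMeasurable (by fun_prop))
    (fun j => MeasureTheory.ae_of_all _ fun θ _ => by
      rw [norm_mul, norm_mul, norm_pow, hnorm, hnorm2, Complex.norm_real, Real.norm_eq_abs])
    (MeasureTheory.ae_of_all _ fun θ _ => hsum.mul_right _)
    intervalIntegrable_const
    (MeasureTheory.ae_of_all _ fun θ _ => ((hp _ (by rw [hnorm]; exact hlt)).2.mul_right _))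
  have hj : ∀ j : ℕ, ∫ θ in (-Real.pi)..Real.pi, ((coeff j p : ℝ) : ℂ) *
      (σ * Complex.exp (-(t - θ * Complex.I))) ^ j * Complex.exp (n * (t - θ * Complex.I)) =
      if j = n then (2 * Real.pi * (σ ^ n * coeff n p : ℝ) : ℂ) else 0 := by
    intro j
    have h1 : ∀ θ : ℝ, ((coeff j p : ℝ) : ℂ) * (σ * Complex.exp (-(t - θ * Complex.I))) ^ j *
        Complex.exp (n * (t - θ * Complex.I)) =
        (coeff j p * σ ^ j * Complex.exp ((n - j) * t)) *
          Complex.exp (((j - n : ℤ) : ℂ) * Complex.I * θ) := fun θ => by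
      rw [mul_pow, ← Complex.exp_nat_mul]
      have : Complex.exp (j * -(t - θ * Complex.I)) * Complex.exp (n * (t - θ * Complex.I)) =
          Complex.exp ((n - j) * t) * Complex.exp (((j - n : ℤ) : ℂ) * Complex.I * θ) := by
        rw [← Complex.exp_add, ← Complex.exp_add]; congr 1; push_cast; ring
      linear_combination ((coeff j p : ℝ) : ℂ) * σ ^ j * this
    simp only [h1]
    rw [intervalIntegral.integral_const_mul, integral_exp_int_mul_I]
    by_cases hjn : j = n
    · rw [if_pos hjn, if_pos (by omega), hjn]
      push_cast
      rw [sub_self, zero_mul, Complex.exp_zero]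
      ring
    · rw [if_neg hjn, if_neg (by omega), mul_zero]
  simp only [hj] at key
  exact (hasSum_ite_eq n _).unique key

open Filter Topology in
theorem tendsto_coeff_partialProd {s t : ℕ} (hs : 1 ≤ s) (ht : 1 ≤ t) (h n : ℕ) :
    Tendsto (fun K => coeff n (∏ k ∈ Finset.range K, qRatio (s * (k + 1)) (t * (k + 1)) ^ h)) atTop
      (𝓝 (coeff n (qProduct s t h))) := by
  have h1 := (qProduct_multipliable hs ht h).hasProd.tendsto_prod_nat
  exact ((PowerSeries.WithPiTopology.continuous_coeff ℝ n).tendsto _).comp h1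

open Filter Topology in
theorem tendsto_partialProd_eval {s t : ℕ} (hs : 1 ≤ s) (ht : 1 ≤ t) (h : ℕ) {q : ℂ}
    (hq : ‖q‖ < 1) :
    Tendsto (fun K => ∏ k ∈ Finset.range K,
        ((1 - q ^ (s * (k + 1))) / (1 - q ^ (t * (k + 1)))) ^ h) atTop
      (𝓝 ((eulerProd (q ^ s) / eulerProd (q ^ t)) ^ h)) := by
  have hpow : ∀ {k : ℕ}, 1 ≤ k → ‖q ^ k‖ < 1 := fun hk => by
    rw [norm_pow]; exact pow_lt_one₀ (norm_nonneg _) hq (by omega)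
  have h1 := (ModularForm.multipliable_one_sub_pow (hpow hs)).hasProd.tendsto_prod_nat
  have h2 := (ModularForm.multipliable_one_sub_pow (hpow ht)).hasProd.tendsto_prod_nat
  refine ((h1.div h2 (eulerProd_ne_zero (hpow ht))).pow h).congr fun K => ?_
  rw [Pi.div_apply, ← Finset.prod_div_distrib, ← Finset.prod_pow]
  simp only [pow_mul]

open Filter Topology in
/-- The partial products are bounded on every circle. -/
theorem exists_norm_partialProd_le {s t : ℕ} (hs : 1 ≤ s) (ht : 1 ≤ t) (h : ℕ) {r : ℝ} (hr0 : 0 ≤ r)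
    (hr : r < 1) : ∃ C : ℝ, ∀ (K : ℕ) (q : ℂ), ‖q‖ = r →
      ‖∏ k ∈ Finset.range K, ((1 - q ^ (s * (k + 1))) / (1 - q ^ (t * (k + 1)))) ^ h‖ ≤ C := by
  have hrn : ‖(r : ℂ)‖ = r := by rw [Complex.norm_real, Real.norm_of_nonneg hr0]
  have hr1 : ‖(r : ℂ)‖ < 1 := by rwa [hrn]
  have h1 : Tendsto (fun K => ∏ k ∈ Finset.range K, (1 + r ^ (k + 1))) atTop
      (𝓝 (∏' k : ℕ, (1 + r ^ (k + 1)))) := by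
    refine (multipliable_one_add_of_summable ?_).hasProd.tendsto_prod_nat
    simpa [hrn] using summable_norm_pow_succ hr1
  have h2 := (ModularForm.multipliable_one_sub_pow hr1).hasProd.norm.tendsto_prod_nat
  have h3 := (h1.div h2 (norm_ne_zero_iff.mpr (eulerProd_ne_zero hr1))).pow h
  obtain ⟨C, hC⟩ := h3.bddAbove_range
  refine ⟨C, fun K q hq => le_trans ?_ (hC ⟨K, rfl⟩)⟩
  have hle : ∀ {a : ℕ} (k : ℕ), 1 ≤ a → r ^ (a * (k + 1)) ≤ r ^ (k + 1) := fun k ha =>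
    pow_le_pow_of_le_one hr0 hr.le (Nat.le_mul_of_pos_left _ ha)
  simp only [Pi.div_apply]
  rw [Finset.prod_pow, norm_pow, norm_prod, ← Finset.prod_div_distrib]
  refine pow_le_pow_left₀ (Finset.prod_nonneg fun _ _ => norm_nonneg _)
    (Finset.prod_le_prod (fun _ _ => norm_nonneg _) fun k _ => ?_) h
  have hrk : r ^ (k + 1) < 1 := pow_lt_one₀ hr0 hr k.succ_ne_zero
  have hden : ‖1 - (r : ℂ) ^ (k + 1)‖ = 1 - r ^ (k + 1) := by
    have := norm_one_sub_norm_pow hr1 (k + 1)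
    rwa [hrn, norm_pow, hrn] at this
  rw [norm_div, hden]
  have hnum : ‖1 - q ^ (s * (k + 1))‖ ≤ 1 + r ^ (k + 1) := by
    refine (norm_sub_le _ _).trans ?_
    rw [norm_one, norm_pow, hq]
    linarith [hle k hs]
  have hden2 : 1 - r ^ (k + 1) ≤ ‖1 - q ^ (t * (k + 1))‖ := by
    have := norm_sub_norm_le 1 (q ^ (t * (k + 1)))
    rw [norm_one, norm_pow, hq] at this
    linarith [hle k ht]
  have : 0 < 1 - r ^ (k + 1) := by linarith
  gcongr

open Filter Topology in
/-- Cauchy's formula for the coefficients of `qProduct`, with a sign change `q ↦ σ q`. -/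
theorem two_pi_mul_coeff_qProduct {s t : ℕ} (hs : 1 ≤ s) (ht : 1 ≤ t) (h : ℕ) {σ : ℝ}
    (hσ : |σ| = 1) {y : ℝ} (hy : 0 < y) (n : ℕ) :
    (2 * Real.pi * (σ ^ n * coeff n (qProduct s t h) : ℝ) : ℂ) = ∫ θ in (-Real.pi)..Real.pi,
      (eulerProd ((σ * Complex.exp (-(y - θ * Complex.I))) ^ s) /
        eulerProd ((σ * Complex.exp (-(y - θ * Complex.I))) ^ t)) ^ h *
        Complex.exp (n * (y - θ * Complex.I)) := by
  have hnorm : ∀ θ : ℝ, ‖(σ : ℂ) * Complex.exp (-(y - θ * Complex.I))‖ = Real.exp (-y) := by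
    intro θ
    rw [norm_mul, Complex.norm_real, Real.norm_eq_abs, hσ, one_mul, Complex.norm_exp]
    simp
  have hlt : Real.exp (-y) < 1 := Real.exp_lt_one_iff.mpr (by linarith)
  have hnorm2 : ∀ θ : ℝ, ‖Complex.exp (n * (y - θ * Complex.I))‖ = Real.exp (n * y) := fun θ => by
    rw [Complex.norm_exp]
    simp
  obtain ⟨C, hC⟩ := exists_norm_partialProd_le hs ht h (Real.exp_pos (-y)).le hlt
  have h1 : Tendsto (fun K => (2 * Real.pi * (σ ^ n * coeff n
      (∏ k ∈ Finset.range K, qRatio (s * (k + 1)) (t * (k + 1)) ^ h) : ℝ) : ℂ)) atTop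
      (𝓝 (2 * Real.pi * (σ ^ n * coeff n (qProduct s t h) : ℝ) : ℂ)) :=
    ((Complex.continuous_ofReal.tendsto _).comp
      ((tendsto_coeff_partialProd hs ht h n).const_mul _)).const_mul _
  refine tendsto_nhds_unique h1 ?_
  simp only [(convergesTo_partialProd s ht h _).two_pi_mul_coeff hσ hy n]
  refine intervalIntegral.tendsto_integral_filter_of_dominated_convergence
    (fun _ => C * Real.exp (n * y)) (Eventually.of_forall fun K => ?_)
    (Eventually.of_forall fun K => MeasureTheory.ae_of_all _ fun θ _ => ?_)
    intervalIntegrable_const (MeasureTheory.ae_of_all _ fun θ _ => ?_)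
  · refine Continuous.aestronglyMeasurable (Continuous.mul (continuous_finsetProd _ fun k _ =>
      Continuous.pow (Continuous.div (by fun_prop) (by fun_prop) fun θ => ?_) h) (by fun_prop))
    exact one_sub_pow_ne_zero (by rw [hnorm]; exact hlt) (Nat.mul_pos ht k.succ_pos).ne'
  · rw [norm_mul, hnorm2]
    gcongr
    exact hC K _ (hnorm θ)
  · exact (tendsto_partialProd_eval hs ht h (by rw [hnorm]; exact hlt)).mul_const _

/-! ### The two families of products -/

open Filter Topology in
/-- A gap off the positive axis, relative to the value on it, gives the bound which the
saddle-point method needs. -/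
theorem exists_bound_of_gap {G : ℂ → ℂ} {A κ t₁ : ℝ} {l : ℂ} (ht₁ : 0 < t₁) (hκ : 0 < κ)
    (hlim : Tendsto (fun z : ℂ => G (Complex.exp (-z)) * Complex.exp (-(A / z))) (𝓝[wedge] 0) (𝓝 l))
    (hgap : ∀ t : ℝ, 0 < t → t ≤ t₁ → ∀ u : ℂ, ‖u‖ = 1 → ‖G (Real.exp (-t) * u)‖ ≤
      ‖G (Real.exp (-t))‖ * Real.exp (-(κ / t * min 1 ((‖1 - u‖ / t) ^ 2)))) :
    ∃ κ' K t₀ : ℝ, 0 < κ' ∧ 0 ≤ K ∧ 0 < t₀ ∧ ∀ t θ : ℝ, 0 < t → t ≤ t₀ → |θ| ≤ Real.pi →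
      ‖G (Complex.exp (-(t - θ * Complex.I)))‖ ≤
        K * Real.exp (A / t - κ' / t * min 1 ((θ / t) ^ 2)) := by
  have hreal : Tendsto (fun t : ℝ => (t : ℂ)) (𝓝[>] 0) (𝓝[wedge] 0) := by
    refine tendsto_nhdsWithin_iff.mpr ⟨?_, ?_⟩
    · simpa using (Complex.continuous_ofReal.tendsto 0).mono_left nhdsWithin_le_nhds
    · filter_upwards [self_mem_nhdsWithin] with t ht
      have : (0 : ℝ) < t := ht
      exact ⟨by simpa using this, by simpa using this.le⟩
  have hev := (hlim.comp hreal).norm.eventually_le_const (lt_add_one ‖l‖)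
  obtain ⟨t₂, ht₂, hle⟩ := mem_nhdsGT_iff_exists_Ioc_subset.mp hev
  set e : ℝ := 2 / Real.pi with he
  have he0 : 0 < e := by positivity
  have he1 : e ≤ 1 := (div_le_one Real.pi_pos).mpr Real.two_le_pi
  refine ⟨κ * e ^ 2, ‖l‖ + 1, min t₁ t₂, by positivity, by positivity, lt_min ht₁ ht₂,
    fun t θ ht ht0 hθ => ?_⟩
  have h1 : ‖G (Real.exp (-t))‖ ≤ (‖l‖ + 1) * Real.exp (A / t) := by
    have h2 := hle ⟨ht, ht0.trans (min_le_right _ _)⟩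
    simp only [Set.mem_ofPred_eq, Function.comp] at h2
    rw [norm_mul, ← Complex.ofReal_div, ← Complex.ofReal_neg, ← Complex.ofReal_neg,
      ← Complex.ofReal_exp, ← Complex.ofReal_exp, Complex.norm_real,
      Real.norm_of_nonneg (Real.exp_pos _).le, Real.exp_neg (A / t), ← div_eq_mul_inv,
      div_le_iff₀ (Real.exp_pos _)] at h2
    exact h2
  rw [exp_neg_sub_mul_I]
  refine (hgap t ht (ht0.trans (min_le_left _ _)) _ (Complex.norm_exp_ofReal_mul_I θ)).trans ?_
  rw [sub_eq_add_neg (A / t), Real.exp_add, ← mul_assoc]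
  have h3 : e * (|θ| / t) ≤ ‖1 - Complex.exp (θ * Complex.I)‖ / t := by
    rw [← mul_div_assoc]
    gcongr
    exact abs_le_norm_one_sub_exp hθ
  have h4 := sq_mul_min_one_le (by positivity) he0.le he1 h3
  rw [div_pow |θ| t, sq_abs, ← div_pow θ t] at h4
  have h5 : κ * e ^ 2 / t * min 1 ((θ / t) ^ 2) ≤
      κ / t * min 1 ((‖1 - Complex.exp (θ * Complex.I)‖ / t) ^ 2) := by
    calc κ * e ^ 2 / t * min 1 ((θ / t) ^ 2) = κ / t * (e ^ 2 * min 1 ((θ / t) ^ 2)) := by ring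
      _ ≤ _ := by gcongr
  exact mul_le_mul h1 (Real.exp_le_exp.mpr (neg_le_neg h5)) (Real.exp_pos _).le (by positivity)

theorem continuousOn_eulerProd_comp {g : ℂ → ℂ} (hg : Continuous g)
    (hlt : ∀ q : ℂ, ‖q‖ < 1 → ‖g q‖ < 1) :
    ContinuousOn (fun q => eulerProd (g q)) (Metric.ball 0 1) :=
  continuousOn_eulerProd.comp hg.continuousOn fun q hq => by
    rw [mem_ball_zero_iff] at hq ⊢
    exact hlt q hq

theorem norm_pow_lt_one {q : ℂ} (hq : ‖q‖ < 1) {k : ℕ} (hk : k ≠ 0) : ‖q ^ k‖ < 1 := by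
  rw [norm_pow]; exact pow_lt_one₀ (norm_nonneg _) hq hk

open Filter in
theorem isEquivalent_coeff_regular {m h : ℕ} (hm : 2 ≤ m) (hh : 1 ≤ h) :
    Asymptotics.IsEquivalent atTop (fun n : ℕ => coeff n (qProduct m 1 h)) (fun n : ℕ =>
      (1 / √m) ^ h * (Real.pi ^ 2 * h * (m - 1) / (6 * m)) ^ (1 / 4 : ℝ) /
        (2 * √Real.pi * (n : ℝ) ^ (3 / 4 : ℝ)) *
        Real.exp (2 * √(Real.pi ^ 2 * h * (m - 1) / (6 * m) * n))) := by
  have hm' : (2 : ℝ) ≤ m := by exact_mod_cast hm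
  have hh' : (1 : ℝ) ≤ h := by exact_mod_cast hh
  have hm1 : 0 < (m : ℝ) - 1 := by linarith
  have hA : 0 < Real.pi ^ 2 * h * (m - 1) / (6 * m) := by positivity
  have hlim := tendsto_regular_wedge (m := m) (h := h) (by omega)
  obtain ⟨κ, hκ, hgap⟩ := exists_norm_regular_le hm hh
  obtain ⟨κ', K, t₀, hκ', hK, ht₀, hbd⟩ := exists_bound_of_gap
    (G := fun q => (eulerProd (q ^ m) / eulerProd q) ^ h) one_pos hκ hlim hgap
  have hcont : ContinuousOn (fun q => (eulerProd (q ^ m) / eulerProd q) ^ h) (Metric.ball 0 1) :=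
    ((continuousOn_eulerProd_comp (continuous_pow m)
      fun q hq => norm_pow_lt_one hq (by omega)).div continuousOn_eulerProd
        fun q hq => eulerProd_ne_zero (mem_ball_zero_iff.mp hq)).pow h
  have hcoef : ∀ t : ℝ, 0 < t → ∀ n : ℕ, (2 * Real.pi * (coeff n (qProduct m 1 h) : ℝ) : ℂ) =
      ∫ θ in (-Real.pi)..Real.pi, (eulerProd (Complex.exp (-(t - θ * Complex.I)) ^ m) /
        eulerProd (Complex.exp (-(t - θ * Complex.I)))) ^ h *
          Complex.exp (n * (t - θ * Complex.I)) := fun t ht n => by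
    have := two_pi_mul_coeff_qProduct (s := m) (t := 1) (by omega) le_rfl h (abs_one (α := ℝ)) ht n
    simpa only [one_pow, one_mul, Complex.ofReal_one, pow_one] using this
  have hl : (1 / √(m : ℝ)) ^ h ≠ 0 := by positivity
  exact isEquivalent_coeff_of_saddle (G := fun q => (eulerProd (q ^ m) / eulerProd q) ^ h)
    (c := fun n => coeff n (qProduct m 1 h)) hA hκ' hK ht₀ hl hcont hcoef hlim hbd

open Filter in
theorem isEquivalent_coeff_odd (m : ℕ) :
    Asymptotics.IsEquivalent atTop
      (fun n : ℕ => (-1) ^ n * coeff n (qProduct (2 * m + 1) 2 1)) (fun n : ℕ =>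
      (1 / √(2 * m + 1 : ℕ)) *
        (Real.pi ^ 2 * (2 * (2 * m + 1 : ℕ) - 1) / (24 * (2 * m + 1 : ℕ))) ^ (1 / 4 : ℝ) /
        (2 * √Real.pi * (n : ℝ) ^ (3 / 4 : ℝ)) *
        Real.exp (2 *
          √(Real.pi ^ 2 * (2 * (2 * m + 1 : ℕ) - 1) / (24 * (2 * m + 1 : ℕ)) * n))) := by
  set M := 2 * m + 1 with hM
  have hM' : (1 : ℝ) ≤ M := by exact_mod_cast (by omega : 1 ≤ M)
  have hM1 : 0 < 2 * (M : ℝ) - 1 := by linarith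
  have hA : 0 < Real.pi ^ 2 * (2 * M - 1) / (24 * M) := by positivity
  have hlim := tendsto_odd_wedge (M := M) (by omega)
  obtain ⟨κ, hκ, t₁, ht₁, hgap⟩ := exists_norm_odd_le m
  obtain ⟨κ', K, t₀, hκ', hK, ht₀, hbd⟩ := exists_bound_of_gap
    (G := fun q => eulerProd (-q ^ M) / eulerProd (q ^ 2)) ht₁ hκ hlim hgap
  have hcont : ContinuousOn (fun q => eulerProd (-q ^ M) / eulerProd (q ^ 2)) (Metric.ball 0 1) :=
    (continuousOn_eulerProd_comp (g := fun q => -q ^ M) (by fun_prop)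
      fun q hq => by rw [norm_neg]; exact norm_pow_lt_one hq (by omega)).div
      (continuousOn_eulerProd_comp (continuous_pow 2) fun q hq => norm_pow_lt_one hq two_ne_zero)
        fun q hq => eulerProd_ne_zero (norm_pow_lt_one (mem_ball_zero_iff.mp hq) two_ne_zero)
  have hcoef : ∀ t : ℝ, 0 < t → ∀ n : ℕ,
      (2 * Real.pi * ((-1) ^ n * coeff n (qProduct M 2 1) : ℝ) : ℂ) =
      ∫ θ in (-Real.pi)..Real.pi, eulerProd (-Complex.exp (-(t - θ * Complex.I)) ^ M) /
        eulerProd (Complex.exp (-(t - θ * Complex.I)) ^ 2) *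
          Complex.exp (n * (t - θ * Complex.I)) := fun t ht n => by
    have := two_pi_mul_coeff_qProduct (s := M) (t := 2) (by omega) one_le_two 1
      (σ := -1) (by simp) ht n
    simpa only [pow_one, Complex.ofReal_neg, Complex.ofReal_one, neg_mul, one_mul, neg_sq,
      Odd.neg_pow (⟨m, hM⟩ : Odd M)] using this
  have hl : 1 / √(M : ℝ) ≠ 0 := by positivity
  exact isEquivalent_coeff_of_saddle (G := fun q => eulerProd (-q ^ M) / eulerProd (q ^ 2))
    (c := fun n => (-1) ^ n * coeff n (qProduct M 2 1)) hA hκ' hK ht₀ hl hcont hcoef hlim hbd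

theorem mainTheorem9 :
    (∀ m h : ℕ, 1 < m → 1 ≤ h →
      Asymptotics.IsEquivalent Filter.atTop
        (fun n : ℕ => PowerSeries.coeff n (qProduct m 1 h))
        (fun n : ℕ =>
          (h : ℝ) ^ (1 / 4 : ℝ) * ((m : ℝ) - 1) ^ (1 / 4 : ℝ)
              * Real.exp (Real.pi * Real.sqrt (2 * (h : ℝ) * ((m : ℝ) - 1) * (n : ℝ) / (3 * (m : ℝ))))
            / ((2 : ℝ) ^ (5 / 4 : ℝ) * (3 : ℝ) ^ (1 / 4 : ℝ)
                * (m : ℝ) ^ (1 / 4 + (h : ℝ) / 2 : ℝ) * (n : ℝ) ^ (3 / 4 : ℝ)))) ∧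
    (∀ m : ℕ,
      Asymptotics.IsEquivalent Filter.atTop
        (fun n : ℕ => PowerSeries.coeff n (qProduct (2 * m + 1) 2 1))
        (fun n : ℕ =>
          (-1 : ℝ) ^ n
            * ((4 * (m : ℝ) + 1) ^ (1 / 4 : ℝ)
              / ((2 : ℝ) ^ (7 / 4 : ℝ) * (3 : ℝ) ^ (1 / 4 : ℝ)
                * (2 * (m : ℝ) + 1) ^ (3 / 4 : ℝ) * (n : ℝ) ^ (3 / 4 : ℝ)))
            * Real.exp (Real.pi * Real.sqrt ((4 * (m : ℝ) + 1) * (n : ℝ) / (6 * (2 * (m : ℝ) + 1)))))) := by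
  have hpi : (Real.pi ^ 2) ^ (1 / 4 : ℝ) = √Real.pi := by
    rw [Real.sqrt_eq_rpow, ← Real.rpow_natCast, ← Real.rpow_mul Real.pi_pos.le]; norm_num
  have hexp : ∀ {a b : ℝ}, 0 ≤ b → a * 4 = Real.pi ^ 2 * b → 2 * √a = Real.pi * √b := by
    intro a b hb h
    have h2 : Real.pi * √b = √(Real.pi ^ 2 * b) := by
      rw [Real.sqrt_mul (by positivity), Real.sqrt_sq Real.pi_pos.le]
    rw [h2, ← h, Real.sqrt_mul' _ (by norm_num), show (4 : ℝ) = 2 ^ 2 by norm_num,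
      Real.sqrt_sq (by norm_num), mul_comm]
  have hspi : 0 < √Real.pi := Real.sqrt_pos.mpr Real.pi_pos
  constructor
  · intro m h hm hh
    have hm' : (1 : ℝ) < m := by exact_mod_cast hm
    have hm1 : 0 < (m : ℝ) - 1 := by linarith
    have hm0 : (0 : ℝ) < m := by linarith
    have hh0 : (0 : ℝ) < h := by exact_mod_cast hh
    refine (isEquivalent_coeff_regular hm hh).congr_right (Filter.Eventually.of_forall fun n => ?_)
    have h1 : (Real.pi ^ 2 * h * (m - 1) / (6 * m)) ^ (1 / 4 : ℝ) =
        √Real.pi * (h : ℝ) ^ (1 / 4 : ℝ) * ((m : ℝ) - 1) ^ (1 / 4 : ℝ) /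
          ((2 : ℝ) ^ (1 / 4 : ℝ) * (3 : ℝ) ^ (1 / 4 : ℝ) * (m : ℝ) ^ (1 / 4 : ℝ)) := by
      rw [Real.div_rpow (by positivity) (by positivity), Real.mul_rpow (by positivity) hm1.le,
        Real.mul_rpow (by positivity) hh0.le, hpi, show (6 : ℝ) = 2 * 3 by norm_num,
        Real.mul_rpow (by norm_num) hm0.le, Real.mul_rpow (by norm_num) (by norm_num)]
    have h2 : (2 : ℝ) ^ (5 / 4 : ℝ) = 2 * (2 : ℝ) ^ (1 / 4 : ℝ) := by
      rw [show (5 / 4 : ℝ) = 1 + 1 / 4 by norm_num, Real.rpow_add two_pos, Real.rpow_one]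
    have h3 : (m : ℝ) ^ (1 / 4 + (h : ℝ) / 2 : ℝ) = (m : ℝ) ^ (1 / 4 : ℝ) * √m ^ h := by
      rw [Real.rpow_add hm0, Real.sqrt_eq_rpow, ← Real.rpow_natCast, ← Real.rpow_mul hm0.le]
      congr 2; ring
    have h4 := hexp (a := Real.pi ^ 2 * h * (m - 1) / (6 * m) * n)
      (b := 2 * (h : ℝ) * ((m : ℝ) - 1) * (n : ℝ) / (3 * (m : ℝ))) (by positivity)
      (by field_simp; ring)
    simp only
    rw [h1, h2, h3, h4, div_pow, one_pow]
    have := Real.sqrt_pos.mpr hm0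
    generalize (n : ℝ) ^ (3 / 4 : ℝ) = N
    field_simp
  · intro m
    have hM0 : (0 : ℝ) < 2 * m + 1 := by positivity
    have hm1 : (0 : ℝ) < 4 * m + 1 := by positivity
    have hsign := (Asymptotics.IsEquivalent.refl (u := fun n : ℕ => (-1 : ℝ) ^ n)
      (l := Filter.atTop)).mul (isEquivalent_coeff_odd m)
    have hl : ((fun n : ℕ => (-1 : ℝ) ^ n) * fun n : ℕ =>
        (-1) ^ n * coeff n (qProduct (2 * m + 1) 2 1)) =
        fun n : ℕ => coeff n (qProduct (2 * m + 1) 2 1) := by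
      funext n
      rw [Pi.mul_apply, ← mul_assoc, ← mul_pow]
      norm_num
    rw [hl] at hsign
    refine hsign.congr_right (Filter.Eventually.of_forall fun n => ?_)
    have h1 : (Real.pi ^ 2 * (4 * m + 1) / (24 * (2 * m + 1))) ^ (1 / 4 : ℝ) =
        √Real.pi * (4 * (m : ℝ) + 1) ^ (1 / 4 : ℝ) /
          ((2 : ℝ) ^ (3 / 4 : ℝ) * (3 : ℝ) ^ (1 / 4 : ℝ) * (2 * (m : ℝ) + 1) ^ (1 / 4 : ℝ)) := by
      rw [Real.div_rpow (by positivity) (by positivity), Real.mul_rpow (by positivity) hm1.le,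
        hpi, show (24 : ℝ) = 2 ^ (3 : ℝ) * 3 by norm_num,
        Real.mul_rpow (by norm_num) hM0.le, Real.mul_rpow (by norm_num) (by norm_num),
        ← Real.rpow_mul two_pos.le]
      norm_num
    have h2 : (2 : ℝ) ^ (7 / 4 : ℝ) = 2 * (2 : ℝ) ^ (3 / 4 : ℝ) := by
      rw [show (7 / 4 : ℝ) = 1 + 3 / 4 by norm_num, Real.rpow_add two_pos, Real.rpow_one]
    have h3 : (2 * (m : ℝ) + 1) ^ (3 / 4 : ℝ) =
        (2 * (m : ℝ) + 1) ^ (1 / 4 : ℝ) * √(2 * (m : ℝ) + 1) := by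
      rw [Real.sqrt_eq_rpow, ← Real.rpow_add hM0]; norm_num
    have h4 := hexp (a := Real.pi ^ 2 * (4 * m + 1) / (24 * (2 * m + 1)) * n)
      (b := (4 * (m : ℝ) + 1) * (n : ℝ) / (6 * (2 * (m : ℝ) + 1))) (by positivity)
      (by field_simp; ring)
    have h5 : 2 * ((2 * m + 1 : ℕ) : ℝ) - 1 = 4 * m + 1 := by push_cast; ring
    simp only [Pi.mul_apply]
    rw [h5]
    push_cast
    rw [h1, h2, h3, h4]
    have := Real.sqrt_pos.mpr hM0
    generalize (n : ℝ) ^ (3 / 4 : ℝ) = N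
    field_simp
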